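/- Let $M$ be a (Hausdorff, finite-dimensional, smooth, boundaryless) manifold, $g$ a smooth Lorentzian metric on $M$ of signature $(-,+,\dots,+)$ and $\omega$ a smooth 1-form on $M$, so that $(M,g,\omega)$ is a Weyl manifold; let $(M,[g],[\omega])$ be its class under the transformations $\bar g=e^{-f}g$, $\bar\omega=\omega-df$ with $f\in C^\infty(M)$. A time-like curve is a piecewise smooth curve $\gamma:[a,b]\to M$, $a<b$, whose velocity (one-sided at end points and break points) satisfies $g(\gamma',\gamma')<0$, and whose two one-sided velocities at each break point lie in the same time cone. For $p\in M$ let $I_p$ be the set of all $q\in M$ for which there is a time-like curve from $p$ to $q$. Suppose that the integral of $\omega$ over time-like curves is path independent: $\int_{\gamma_1}\omega=\int_{\gamma_2}\omega$ whenever $\gamma_1,\gamma_2$ are time-like curves from an event $A$ to an event $B$. Then: 1. For every $p\in M$ the set $I_p$ is open, and there are a function $f:M\to\mathbb R$ with $f(p)=0$ and an open neighbourhood $U$ of $p$ such that $f(q)=\int_\gamma\omega$ for every $q\in I_p$ and every time-like curve $\gamma$ from $p$ to $q$, and $f$ is smooth (in particular differentiable) on $I_p\cup U$ with $df=\omega$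 there. 2. $\omega$ is locally exact: every point of $M$ has an open neighbourhood on which $\omega=dF$ for some smooth function $F$. 3. $\omega$ is closed, $d\omega=0$. 4. If moreover $M$ is simply connected, then $\omega$ is exact, $\omega=d\phi$ with $\phi\in C^\infty(M)$, and the Weyl structure $(M,[g],[\omega])$ is integrable (a Weyl integrable space-time), i.e. the 1-form of every representative of the class is exact. -/

import Mathlib

open Set
open scoped Manifold ContDiff Topology

noncomputable section

namespace WeylSpaceTime

/-- A smooth Lorentzian metric on a manifold `M` modelled on `E`: a smooth field of symmetric
bilinear forms of signature `(-, +, ..., +)` on the tangent spaces. The signature is expressed by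
the existence of a vector `e` with `g (e, e) < 0` on whose orthogonal complement the form is
positive definite. -/
structure LorentzMetric (E : Type*) [NormedAddCommGroup E] [NormedSpace ℝ E]
    (M : Type*) [TopologicalSpace M] [ChartedSpace E M] [IsManifold 𝓘(ℝ, E) ∞ M] where
  toFun : ∀ x : M, TangentSpace 𝓘(ℝ, E) x →L[ℝ] TangentSpace 𝓘(ℝ, E) x →L[ℝ] ℝ
  symm : ∀ (x : M) (v w : TangentSpace 𝓘(ℝ, E) x), toFun x v w = toFun x w v
  signature : ∀ x : M, ∃ e : TangentSpace 𝓘(ℝ, E) x, toFun x e e < 0 ∧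
    ∀ w : TangentSpace 𝓘(ℝ, E) x, toFun x e w = 0 → w ≠ 0 → 0 < toFun x w w
  smooth : ContMDiff 𝓘(ℝ, E) (𝓘(ℝ, E).prod 𝓘(ℝ, E →L[ℝ] E →L[ℝ] ℝ)) ∞
    (fun x : M ↦ Bundle.TotalSpace.mk' (E →L[ℝ] E →L[ℝ] ℝ) x (toFun x))

/-- A smooth 1-form field on `M`. -/
structure OneForm (E : Type*) [NormedAddCommGroup E] [NormedSpace ℝ E]
    (M : Type*) [TopologicalSpace M] [ChartedSpace E M] [IsManifold 𝓘(ℝ, E) ∞ M] where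
  toFun : ∀ x : M, TangentSpace 𝓘(ℝ, E) x →L[ℝ] ℝ
  smooth : ContMDiff 𝓘(ℝ, E) (𝓘(ℝ, E).prod 𝓘(ℝ, E →L[ℝ] ℝ)) ∞
    (fun x : M ↦ Bundle.TotalSpace.mk' (E →L[ℝ] ℝ) x (toFun x))

variable {E : Type*} [NormedAddCommGroup E] [NormedSpace ℝ E]
  {M : Type*} [TopologicalSpace M] [ChartedSpace E M] [IsManifold 𝓘(ℝ, E) ∞ M]

namespace OneForm

/-- `f` is smooth on the (open) set `U` and `df = θ` there. -/
def IsPrimitiveOn (θ : OneForm E M) (f : M → ℝ) (U : Set M) : Prop :=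
  ContMDiffOn 𝓘(ℝ, E) 𝓘(ℝ, ℝ) ∞ f U ∧
    ∀ x ∈ U, HasMFDerivAt 𝓘(ℝ, E) 𝓘(ℝ, ℝ) f x (θ.toFun x)

/-- `θ = dφ` for a smooth function `φ` on all of `M`. -/
def IsExact (θ : OneForm E M) : Prop :=
  ∃ φ : M → ℝ, θ.IsPrimitiveOn φ univ

/-- Every point has an open neighbourhood on which `θ` is the differential of a smooth function. -/
def IsLocallyExact (θ : OneForm E M) : Prop :=
  ∀ x : M, ∃ U : Set M, IsOpen U ∧ x ∈ U ∧ ∃ F : M → ℝ, θ.IsPrimitiveOn F U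

/-- The expression of `θ` in the preferred chart at `x₀`: the pullback of `θ` by the inverse of
the chart, as a differential form of degree one on the model space (meaningful on the target of
the chart). -/
def inChart (θ : OneForm E M) (x₀ : M) (y : E) : E [⋀^Fin 1]→L[ℝ] ℝ :=
  ContinuousAlternatingMap.ofSubsingleton ℝ E ℝ (0 : Fin 1)
    ((θ.toFun ((extChartAt 𝓘(ℝ, E) x₀).symm y)).comp
      (mfderiv 𝓘(ℝ, E) 𝓘(ℝ, E) (extChartAt 𝓘(ℝ, E) x₀).symm y))

/-- `dθ = 0`, the exterior derivative being computed in charts. -/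
def IsClosedForm (θ : OneForm E M) : Prop :=
  ∀ x₀ : M, ∀ y ∈ (extChartAt 𝓘(ℝ, E) x₀).target, extDeriv (θ.inChart x₀) y = 0

/-- The integral of `θ` along the curve `γ` restricted to `[a, b]`. -/
def curveIntegral (θ : OneForm E M) (γ : ℝ → M) (a b : ℝ) : ℝ :=
  ∫ s in a..b, θ.toFun (γ s) (mfderiv 𝓘(ℝ, ℝ) 𝓘(ℝ, E) γ s (1 : ℝ))

end OneForm

/-- The velocity at the parameter `s` of the restriction of `γ` to `[c, d]`
(one-sided at `s = c` and `s = d`). -/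
def velocityOn (γ : ℝ → M) (c d s : ℝ) : TangentSpace 𝓘(ℝ, E) (γ s) :=
  mfderivWithin 𝓘(ℝ, ℝ) 𝓘(ℝ, E) γ (Icc c d) s (1 : ℝ)

namespace LorentzMetric

/-- `γ` restricted to `[a, b]`, `a < b`, is a piecewise smooth time-like curve: there is a
subdivision `a = t 0 < t 1 < ... < t (n + 1) = b` such that `γ` is smooth with time-like velocity
on each `[t i, t (i + 1)]`, and at each break point the two one-sided velocities lie in the same
(open) time cone, i.e. their product is negative. Smooth time-like curves are the case `n = 0`. -/
def IsTimelikeCurve (g : LorentzMetric E M) (γ : ℝ → M) (a b : ℝ) : Prop :=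
  ∃ (n : ℕ) (t : ℕ → ℝ), t 0 = a ∧ t (n + 1) = b ∧
    (∀ i ≤ n, t i < t (i + 1)) ∧
    (∀ i ≤ n, ContMDiffOn 𝓘(ℝ, ℝ) 𝓘(ℝ, E) ∞ γ (Icc (t i) (t (i + 1)))) ∧
    (∀ i ≤ n, ∀ s ∈ Icc (t i) (t (i + 1)),
      g.toFun (γ s) (velocityOn γ (t i) (t (i + 1)) s)
        (velocityOn γ (t i) (t (i + 1)) s) < 0) ∧
    (∀ i < n, g.toFun (γ (t (i + 1))) (velocityOn γ (t i) (t (i + 1)) (t (i + 1)))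
      (velocityOn γ (t (i + 1)) (t (i + 2)) (t (i + 1))) < 0)

/-- `γ` restricted to `[a, b]` is a time-like curve from the event `p` to the event `q`. -/
def Joins (g : LorentzMetric E M) (γ : ℝ → M) (a b : ℝ) (p q : M) : Prop :=
  g.IsTimelikeCurve γ a b ∧ γ a = p ∧ γ b = q

/-- The set `I_p` of the events that can be joined to `p` by a time-like curve. -/
def causalSet (g : LorentzMetric E M) (p : M) : Set M :=
  {q | ∃ (γ : ℝ → M) (a b : ℝ), g.Joins γ a b p q}

end LorentzMetric

/-- A Weyl manifold `(M, g, ω)` of Lorentzian signature. -/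
structure WeylManifold (E : Type*) [NormedAddCommGroup E] [NormedSpace ℝ E]
    (M : Type*) [TopologicalSpace M] [ChartedSpace E M] [IsManifold 𝓘(ℝ, E) ∞ M] where
  metric : LorentzMetric E M
  form : OneForm E M

namespace WeylManifold

/-- The integral of `ω` over a time-like curve depends only on the two events it joins. -/
def IsPathIndependent (W : WeylManifold E M) : Prop :=
  ∀ (A B : M) (γ₁ : ℝ → M) (a₁ b₁ : ℝ) (γ₂ : ℝ → M) (a₂ b₂ : ℝ),
    W.metric.Joins γ₁ a₁ b₁ A B → W.metric.Joins γ₂ a₂ b₂ A B →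
      W.form.curveIntegral γ₁ a₁ b₁ = W.form.curveIntegral γ₂ a₂ b₂

/-- The Weyl transformations `g' = exp (-f) g`, `ω' = ω - df` (that is,
`df = ω - ω'`), with `f` smooth. -/
def GaugeEquiv (W W' : WeylManifold E M) : Prop :=
  ∃ f : M → ℝ, ContMDiff 𝓘(ℝ, E) 𝓘(ℝ, ℝ) ∞ f ∧
    (∀ (x : M) (v w : TangentSpace 𝓘(ℝ, E) x),
      W'.metric.toFun x v w = Real.exp (-f x) * W.metric.toFun x v w) ∧
    ∀ x : M, HasMFDerivAt 𝓘(ℝ, E) 𝓘(ℝ, ℝ) f x (W.form.toFun x - W'.form.toFun x)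

theorem GaugeEquiv.refl (W : WeylManifold E M) : GaugeEquiv W W := by
  refine ⟨fun _ ↦ 0, contMDiff_const, fun x v w ↦ by simp, fun x ↦ ?_⟩
  rw [sub_self]
  exact hasMFDerivAt_const _ _

theorem GaugeEquiv.symm {W W' : WeylManifold E M} (h : GaugeEquiv W W') : GaugeEquiv W' W := by
  obtain ⟨f, hf, hg, hd⟩ := h
  refine ⟨-f, contDiff_neg.comp_contMDiff hf, fun x v w ↦ ?_, fun x ↦ ?_⟩
  · rw [hg, ← mul_assoc, ← Real.exp_add]
    simp
  · rw [← neg_sub]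
    exact (hd x).neg

theorem GaugeEquiv.trans {W W' W'' : WeylManifold E M} (h : GaugeEquiv W W')
    (h' : GaugeEquiv W' W'') : GaugeEquiv W W'' := by
  obtain ⟨f, hf, hg, hd⟩ := h
  obtain ⟨f', hf', hg', hd'⟩ := h'
  refine ⟨f + f', hf.add hf', fun x v w ↦ ?_, fun x ↦ ?_⟩
  · rw [hg', hg, ← mul_assoc, ← Real.exp_add]
    simp [add_comm]
  · rw [← sub_add_sub_cancel _ (W'.form.toFun x)]
    exact (hd x).add (hd' x)

end WeylManifold

/-- The equivalence relation on Weyl manifolds given by the Weyl transformations. -/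
def weylSetoid (E : Type*) [NormedAddCommGroup E] [NormedSpace ℝ E]
    (M : Type*) [TopologicalSpace M] [ChartedSpace E M] [IsManifold 𝓘(ℝ, E) ∞ M] :
    Setoid (WeylManifold E M) where
  r := WeylManifold.GaugeEquiv
  iseqv := ⟨WeylManifold.GaugeEquiv.refl, WeylManifold.GaugeEquiv.symm,
    WeylManifold.GaugeEquiv.trans⟩

/-- Weyl structures `(M, [g], [ω])`: equivalence classes of Weyl manifolds. -/
def WeylStructure (E : Type*) [NormedAddCommGroup E] [NormedSpace ℝ E]
    (M : Type*) [TopologicalSpace M] [ChartedSpace E M] [IsManifold 𝓘(ℝ, E) ∞ M] : Type _ :=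
  Quotient (weylSetoid E M)

/-- The Weyl structure `(M, [g], [ω])` represented by `(M, g, ω)`. -/
def WeylManifold.toWeylStructure (W : WeylManifold E M) : WeylStructure E M :=
  Quotient.mk (weylSetoid E M) W

/-- A Weyl structure is integrable (a Weyl integrable space-time) if the 1-form of each of its
representatives is exact. -/
def WeylStructure.IsIntegrable (c : WeylStructure E M) : Prop :=
  ∀ W : WeylManifold E M, W.toWeylStructure = c → W.form.IsExact

end WeylSpaceTime

end

/-!
The argument is local and rests on the openness of the time cones.

Around an event, in a chart, all the vectors of a small ball around a time-like vector `e` are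
time-like at all nearby events, and in the same time cone (`LorentzMetric.exists_isUniformCone`).
Hence the end of a time-like curve from `p` to `q` can be replaced by a straight segment ending at
any event near `q` (`LorentzMetric.IsTimelikeFrom.exists_reach`), so that `I_p` is open, and these
curves can be prolonged by segments with directions near `e`. Path independence therefore
determines the increments of the potential `q ↦ ∫ ω` along such segments. Two neighbouring events
have a common nearby event in their futures, so these increments already give the differential of
the potential, which is `ω` (`hasFDerivAt_of_integral_eq_on_cone`,
`WeylManifold.IsPathIndependent.hasMFDerivAt_potential`). Every event lies in some `I_p`, so `ω` is
locally exact, hence closed.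

The event `p` itself need not lie in `I_p`, and an event near `p` may be reached from `p` only by
long time-like curves. Such a curve arrives at `q` with a velocity which is not orthogonal to the
time-like vector `e` (`LorentzMetric.toFun_ne_zero_of_timelike`), so it can be prolonged in the
direction of `e` or of `-e`, until an event which is also reached from `p` by a short segment. Path
independence then shows that the potential agrees near `p` with a local primitive of `ω`
(`WeylManifold.IsPathIndependent.exists_primitive_near`), which extends it smoothly across `p`. No
time orientation of `M` is needed.

On a simply connected manifold, the covering by the germs of primitives of `ω` has a global
section, which is a primitive of `ω` (`OneForm.IsLocallyExact.isExact`); a Weyl transformation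
changes `ω` by an exact form.
-/

/-! ### Functions with prescribed increments in the directions of a cone -/

section ConeIncrements

variable {E : Type*} [NormedAddCommGroup E] [NormedSpace ℝ E]

lemma add_smul_mem_of_convex {s : Set E} (hs : Convex ℝ s) {z w : E} {T t : ℝ} (hz : z ∈ s)
    (hzT : z + T • w ∈ s) (ht : t ∈ Icc (0 : ℝ) T) : z + t • w ∈ s := by
  rcases ht.1.eq_or_lt with rfl | h0
  · simpa using hz
  · have hT : 0 < T := h0.trans_le ht.2
    have := hs.add_smul_mem hz hzT (t := t / T) ⟨by positivity, (div_le_one hT).2 ht.2⟩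
    rwa [smul_smul, div_mul_cancel₀ _ hT.ne'] at this

lemma abs_integral_segment_sub_le {α : E → E →L[ℝ] ℝ} {y : E} {r ε : ℝ}
    (hα : ContinuousOn α (Metric.ball y r)) (hε : ∀ z ∈ Metric.ball y r, ‖α z - α y‖ ≤ ε)
    {z w : E} {T : ℝ} (hT : 0 < T) (hz : z ∈ Metric.ball y r)
    (hzT : z + T • w ∈ Metric.ball y r) :
    |(∫ s in (0 : ℝ)..T, α (z + s • w) w) - α y (T • w)| ≤ ε * ‖w‖ * T := by
  have hseg : ∀ s ∈ Icc (0 : ℝ) T, z + s • w ∈ Metric.ball y r := fun s hs ↦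
    add_smul_mem_of_convex (convex_ball y r) hz hzT hs
  have hint : IntervalIntegrable (fun s : ℝ ↦ α (z + s • w) w) MeasureTheory.volume 0 T := by
    refine ContinuousOn.intervalIntegrable ?_
    rw [uIcc_of_le hT.le]
    exact (hα.comp (by fun_prop) hseg).clm_apply continuousOn_const
  have hconst : α y (T • w) = ∫ _ in (0 : ℝ)..T, α y w := by simp
  rw [hconst, ← intervalIntegral.integral_sub hint (by simp), ← Real.norm_eq_abs]
  refine (intervalIntegral.norm_integral_le_of_norm_le_const (C := ε * ‖w‖)
    fun s hs ↦ ?_).trans_eq (by rw [sub_zero, abs_of_pos hT])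
  rw [uIoc_of_le hT.le] at hs
  have := (α (z + s • w) - α y).le_of_opNorm_le (hε _ (hseg s ⟨hs.1.le, hs.2⟩)) w
  simpa using this

/-- A function whose increments along all short segments with directions in a fixed open cone are
the integrals of a continuous 1-form has this 1-form as its derivative. A point `y'` near `y` is
compared with `y` through the point `y + T • e`, with `T` a large multiple of `‖y' - y‖`: the
directions from `y` and from `y'` to that point both lie in the cone. -/
theorem hasFDerivAt_of_integral_eq_on_cone {F : E → ℝ} {α : E → E →L[ℝ] ℝ} {y e : E} {ρ δ : ℝ}
    (hρ : 0 < ρ) (hδ : 0 < δ) (hα : ContinuousOn α (Metric.ball y ρ))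
    (hF : ∀ z ∈ Metric.ball y ρ, ∀ T > 0, ∀ w ∈ Metric.ball e δ, z + T • w ∈ Metric.ball y ρ →
      F (z + T • w) - F z = ∫ s in (0 : ℝ)..T, α (z + s • w) w) :
    HasFDerivAt F (α y) y := by
  refine .of_isLittleO (Asymptotics.isLittleO_iff.2 fun c hc ↦ ?_)
  set K : ℝ := 2 / δ with hK
  have hKpos : 0 < K := by positivity
  set C : ℝ := K * (2 * ‖e‖ + δ) with hC
  have hCpos : 0 < C := by positivity
  obtain ⟨r, hr0, hrρ, hr⟩ : ∃ r > 0, r ≤ ρ ∧ ∀ z ∈ Metric.ball y r, ‖α z - α y‖ ≤ c / C := by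
    have h1 : ContinuousAt α y := hα.continuousAt (Metric.ball_mem_nhds y hρ)
    obtain ⟨r, hr0, hr⟩ := Metric.continuousAt_iff.1 h1 (c / C) (by positivity)
    refine ⟨min r ρ, lt_min hr0 hρ, min_le_right _ _, fun z hz ↦ ?_⟩
    rw [← dist_eq_norm]
    exact (hr (Metric.ball_subset_ball (min_le_left _ _) hz)).le
  have hsub : Metric.ball y r ⊆ Metric.ball y ρ := Metric.ball_subset_ball hrρ
  have hη : 0 < r / (K * ‖e‖ + 1) := by positivity
  filter_upwards [Metric.ball_mem_nhds y hη] with y' hy'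
  rcases eq_or_ne y' y with rfl | hne
  · simp
  set h : E := y' - y with hh
  have hhpos : 0 < ‖h‖ := norm_pos_iff.2 (sub_ne_zero.2 hne)
  rw [Metric.mem_ball, dist_eq_norm, ← hh, lt_div_iff₀ (by positivity)] at hy'
  set T : ℝ := K * ‖h‖ with hT
  have hTpos : 0 < T := by positivity
  set w : E := e - T⁻¹ • h with hw
  have hTh : ‖T⁻¹ • h‖ = δ / 2 := by
    rw [norm_smul, norm_inv, Real.norm_of_nonneg hTpos.le, hT, hK]
    field_simp
  have hwball : w ∈ Metric.ball e δ := by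
    rw [Metric.mem_ball, dist_eq_norm, hw, sub_sub_cancel_left, norm_neg, hTh]
    linarith
  have hwnorm : ‖w‖ ≤ ‖e‖ + δ := by
    refine (norm_sub_le _ _).trans ?_
    rw [hTh]
    linarith
  have hTw : T • w = T • e - h := by
    rw [hw, smul_sub, smul_smul, mul_inv_cancel₀ hTpos.ne', one_smul]
  have hmeet : y' + T • w = y + T • e := by
    rw [hTw, hh]
    abel
  have hy : y ∈ Metric.ball y r := Metric.mem_ball_self hr0
  have hy'r : y' ∈ Metric.ball y r := by
    rw [Metric.mem_ball, dist_eq_norm, ← hh]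
    nlinarith [norm_nonneg e, mul_nonneg hKpos.le (norm_nonneg e)]
  have hye : y + T • e ∈ Metric.ball y r := by
    rw [Metric.mem_ball, dist_eq_norm, add_sub_cancel_left, norm_smul,
      Real.norm_of_nonneg hTpos.le, hT]
    nlinarith
  have h1 := abs_integral_segment_sub_le (hα.mono hsub) hr hTpos hy hye
  have h2 := abs_integral_segment_sub_le (hα.mono hsub) hr hTpos hy'r (by rwa [hmeet])
  rw [← hF y (hsub hy) T hTpos e (Metric.mem_ball_self hδ) (hsub hye)] at h1
  rw [← hF y' (hsub hy'r) T hTpos w hwball (by rw [hmeet]; exact hsub hye), hmeet, hTw,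
    map_sub] at h2
  have hεpos : 0 ≤ c / C := by positivity
  have h3 : c / C * ‖w‖ * T ≤ c / C * (‖e‖ + δ) * T := by gcongr
  have h4 : c / C * ‖e‖ * T + c / C * (‖e‖ + δ) * T = c * ‖h‖ := by
    have : c / C * ‖e‖ * T + c / C * (‖e‖ + δ) * T = c / C * C * ‖h‖ := by
      rw [hT]
      nth_rewrite 4 [hC]
      ring
    rw [this, div_mul_cancel₀ _ hCpos.ne']
  rw [abs_le] at h1 h2
  rw [Real.norm_eq_abs, abs_le]
  constructor <;> linarith

end ConeIncrements

namespace WeylSpaceTime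

variable {E : Type*} [NormedAddCommGroup E] [NormedSpace ℝ E]
  {M : Type*} [TopologicalSpace M] [ChartedSpace E M] [IsManifold 𝓘(ℝ, E) ∞ M]

/-! ### Coordinate expressions -/

/-- The differential at `y` of the inverse of the preferred chart at `x₀`. Tangent spaces are
identified with the model space `E`, to which they are equal by definition. -/
noncomputable def chartSymmDeriv (x₀ : M) (y : E) :
    E →L[ℝ] E :=
  mfderiv 𝓘(ℝ, E) 𝓘(ℝ, E) (extChartAt 𝓘(ℝ, E) x₀).symm y

/-- The coordinate expression of a 1-form in the preferred chart at `x₀`. -/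
noncomputable def OneForm.chartForm (θ : OneForm E M) (x₀ : M) (y : E) : E →L[ℝ] ℝ :=
  (θ.toFun ((extChartAt 𝓘(ℝ, E) x₀).symm y)).comp (chartSymmDeriv x₀ y)

/-- The coordinate expression of a Lorentzian metric in the preferred chart at `x₀`. -/
noncomputable def LorentzMetric.chartMetric (g : LorentzMetric E M) (x₀ : M) (y : E) :
    E →L[ℝ] E →L[ℝ] ℝ :=
  ContinuousLinearMap.bilinearComp (E := E) (F := E)
    (g.toFun ((extChartAt 𝓘(ℝ, E) x₀).symm y)) (chartSymmDeriv x₀ y) (chartSymmDeriv x₀ y)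

lemma LorentzMetric.chartMetric_apply (g : LorentzMetric E M) (x₀ : M) (y v w : E) :
    g.chartMetric x₀ y v w = g.toFun ((extChartAt 𝓘(ℝ, E) x₀).symm y)
      (chartSymmDeriv x₀ y v) (chartSymmDeriv x₀ y w) := rfl

lemma contMDiffOn_chart_symm (x₀ : M) :
    ContMDiffOn 𝓘(ℝ, E) 𝓘(ℝ, E) ∞ (extChartAt 𝓘(ℝ, E) x₀).symm
      (extChartAt 𝓘(ℝ, E) x₀).target :=
  contMDiffOn_extChartAt_symm x₀

lemma mdifferentiableAt_chart_symm {x₀ : M} {y : E}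
    (hy : y ∈ (extChartAt 𝓘(ℝ, E) x₀).target) :
    MDifferentiableAt 𝓘(ℝ, E) 𝓘(ℝ, E) (extChartAt 𝓘(ℝ, E) x₀).symm y :=
  (((contMDiffOn_chart_symm x₀) y hy).contMDiffAt
    ((isOpen_extChartAt_target x₀).mem_nhds hy)).mdifferentiableAt (by simp)

lemma hasMFDerivAt_chart_symm {x₀ : M} {y : E}
    (hy : y ∈ (extChartAt 𝓘(ℝ, E) x₀).target) :
    HasMFDerivAt 𝓘(ℝ, E) 𝓘(ℝ, E) (extChartAt 𝓘(ℝ, E) x₀).symm y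
      (chartSymmDeriv (E := E) x₀ y) :=
  (mdifferentiableAt_chart_symm hy).hasMFDerivAt

/-- At the centre of a chart the differential of the chart is the identity, by the definition of the
tangent space there. -/
lemma chartSymmDeriv_self (x₀ : M) (v : E) :
    chartSymmDeriv x₀ (extChartAt 𝓘(ℝ, E) x₀ x₀) v = (v : E) := by
  have := mfderivWithin_range_extChartAt_symm (I := 𝓘(ℝ, E)) (x := x₀)
  rw [modelWithCornersSelf_coe, range_id, mfderivWithin_univ] at this
  have h2 := congrArg (fun (L : E →L[ℝ] E) => L v) this
  exact h2

/-- A coordinate vector field of the preferred chart at `x₀` is smooth. -/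
lemma contMDiffOn_chartSymmDeriv (x₀ : M) (v : E) :
    ContMDiffOn 𝓘(ℝ, E) (𝓘(ℝ, E).prod 𝓘(ℝ, E)) ∞
      (fun y : E ↦ (Bundle.TotalSpace.mk' E ((extChartAt 𝓘(ℝ, E) x₀).symm y)
        (chartSymmDeriv x₀ y v) : TangentBundle 𝓘(ℝ, E) M))
      (extChartAt 𝓘(ℝ, E) x₀).target := by
  have h1 := (contMDiffOn_chart_symm (E := E) x₀).contMDiffOn_tangentMapWithin (m := ∞) (by simp)
    (isOpen_extChartAt_target x₀).uniqueMDiffOn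
  have h2 : ContMDiff 𝓘(ℝ, E) (𝓘(ℝ, E).prod 𝓘(ℝ, E)) ∞
      (fun y : E ↦ (Bundle.TotalSpace.mk' E y v : TangentBundle 𝓘(ℝ, E) E)) := by
    intro y
    refine Bundle.contMDiffAt_totalSpace.2 ⟨contMDiffAt_id, ?_⟩
    simpa using contMDiffAt_const
  have h3 := h1.comp (h2.contMDiffOn (s := (extChartAt 𝓘(ℝ, E) x₀).target)) (fun y hy ↦ hy)
  refine h3.congr fun y hy ↦ ?_
  simp only [Function.comp_apply, tangentMapWithin, chartSymmDeriv]
  rw [mfderivWithin_of_isOpen (isOpen_extChartAt_target x₀) hy]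
  rfl

variable [FiniteDimensional ℝ E]

lemma OneForm.contDiffOn_chartForm (θ : OneForm E M) (x₀ : M) :
    ContDiffOn ℝ ∞ (θ.chartForm x₀) (extChartAt 𝓘(ℝ, E) x₀).target := by
  rw [contDiffOn_clm_apply]
  intro v
  rw [← contMDiffOn_iff_contDiffOn]
  have h1 := θ.smooth.comp_contMDiffOn (contMDiffOn_chart_symm x₀)
  have h2 := ContMDiffOn.clm_bundle_apply (F₁ := E) (F₂ := ℝ)
    (E₁ := fun x : M ↦ TangentSpace 𝓘(ℝ, E) x) (E₂ := Bundle.Trivial M ℝ)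
    (b := (extChartAt 𝓘(ℝ, E) x₀).symm) h1 (contMDiffOn_chartSymmDeriv x₀ v)
  intro y hy
  have h3 := h2 y hy
  rw [Bundle.contMDiffWithinAt_totalSpace] at h3
  exact h3.2

lemma LorentzMetric.continuousOn_chartMetric (g : LorentzMetric E M) (x₀ : M) :
    ContinuousOn (g.chartMetric x₀) (extChartAt 𝓘(ℝ, E) x₀).target := by
  rw [continuousOn_clm_apply]
  intro v
  rw [continuousOn_clm_apply]
  intro w
  have h1 := g.smooth.comp_contMDiffOn (contMDiffOn_chart_symm x₀)
  have h2 := ContMDiffOn.clm_bundle_apply₂ (F₁ := E) (F₂ := E) (F₃ := ℝ)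
    (E₁ := fun x : M ↦ TangentSpace 𝓘(ℝ, E) x) (E₂ := fun x : M ↦ TangentSpace 𝓘(ℝ, E) x)
    (E₃ := Bundle.Trivial M ℝ)
    (b := (extChartAt 𝓘(ℝ, E) x₀).symm) h1 (contMDiffOn_chartSymmDeriv x₀ v)
    (contMDiffOn_chartSymmDeriv x₀ w)
  intro y hy
  have h3 := h2 y hy
  rw [Bundle.contMDiffWithinAt_totalSpace] at h3
  exact h3.2.continuousWithinAt

end WeylSpaceTime

namespace WeylSpaceTime

variable {E : Type*} [NormedAddCommGroup E] [NormedSpace ℝ E]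
  {M : Type*} [TopologicalSpace M] [ChartedSpace E M]

/-! ### Time-like vectors -/

section TimelikeVectors

variable [IsManifold 𝓘(ℝ, E) ∞ M]

/-- Two time-like vectors at the same event are never orthogonal. Otherwise the form would be
negative definite on the plane they span, and that plane meets the orthogonal complement of the
vector provided by the signature, where the form is positive definite. -/
lemma LorentzMetric.toFun_ne_zero_of_timelike (g : LorentzMetric E M) {x : M}
    {v w : TangentSpace 𝓘(ℝ, E) x} (hv : g.toFun x v v < 0) (hw : g.toFun x w w < 0) :
    g.toFun x v w ≠ 0 := by
  intro h
  obtain ⟨e, -, hpos⟩ := g.signature x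
  set α := g.toFun x e w with hα
  set β := g.toFun x e v with hβ
  have hwv : g.toFun x w v = 0 := by rw [g.symm, h]
  have he : g.toFun x e (α • v - β • w) = 0 := by
    simp only [map_sub, map_smul, smul_eq_mul, ← hα, ← hβ]
    ring
  have hsq : g.toFun x (α • v - β • w) (α • v - β • w)
      = α ^ 2 * g.toFun x v v + β ^ 2 * g.toFun x w w := by
    simp only [map_sub, map_smul, smul_eq_mul, sub_apply, smul_apply, h, hwv]
    ring
  by_cases h0 : α • v - β • w = 0
  · have h1 : g.toFun x v (α • v - β • w) = 0 := by rw [h0, map_zero]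
    simp only [map_sub, map_smul, smul_eq_mul, h, mul_zero, sub_zero] at h1
    have hα0 : α = 0 := by
      rcases mul_eq_zero.1 h1 with h1 | h1
      · exact h1
      · exact absurd h1 hv.ne
    have hw0 : w ≠ 0 := by
      rintro rfl
      simp at hw
    exact absurd (hpos w (by rw [← hα, hα0]) hw0) (not_lt.2 hw.le)
  · have := hpos _ he h0
    rw [hsq] at this
    nlinarith [sq_nonneg α, sq_nonneg β]

/-- Since all tangent spaces are the model space `E`, vectors can be moved between equal points
without transport. -/
lemma LorentzMetric.toFun_congr_point (g : LorentzMetric E M) {x y : M} (h : x = y) (v w : E) :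
    g.toFun x (v : E) (w : E) = g.toFun y (v : E) (w : E) := by
  subst h
  rfl

lemma OneForm.toFun_congr_point (θ : OneForm E M) {x y : M} (h : x = y) (v : E) :
    θ.toFun x (v : E) = θ.toFun y (v : E) := by
  subst h
  rfl

end TimelikeVectors

/-! ### Velocities -/

section Velocity

variable {γ γ' : ℝ → M} {c c' d d' s : ℝ}

lemma velocityOn_congr (h : EqOn γ γ' (Icc c d)) (hs : s ∈ Icc c d) :
    (velocityOn γ c d s : E) = velocityOn γ' c d s := by
  have := mfderivWithin_congr (I := 𝓘(ℝ, ℝ)) (I' := 𝓘(ℝ, E)) h (h hs)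
  exact congrArg (fun L : ℝ →L[ℝ] E ↦ L 1) this

lemma velocityOn_eq_of_hasMFDerivWithinAt (hcd : c < d) (hs : s ∈ Icc c d) {L : ℝ →L[ℝ] E}
    (h : HasMFDerivWithinAt 𝓘(ℝ, ℝ) 𝓘(ℝ, E) γ (Icc c d) s L) :
    (velocityOn γ c d s : E) = L 1 := by
  have := h.mfderivWithin ((uniqueDiffOn_Icc hcd s hs).uniqueMDiffWithinAt)
  exact congrArg (fun L : ℝ →L[ℝ] E ↦ L 1) this

lemma velocityOn_eq_mfderiv (hs : s ∈ Ioo c d) :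
    (velocityOn γ c d s : E) = mfderiv 𝓘(ℝ, ℝ) 𝓘(ℝ, E) γ s (1 : ℝ) := by
  rw [velocityOn, mfderivWithin_of_mem_nhds (Icc_mem_nhds hs.1 hs.2)]

lemma velocityOn_of_subset (hc : c ≤ c') (hcd : c' < d') (hd : d' ≤ d)
    (hs : s ∈ Icc c' d') (hγ : ContMDiffOn 𝓘(ℝ, ℝ) 𝓘(ℝ, E) ∞ γ (Icc c d)) :
    (velocityOn γ c' d' s : E) = velocityOn γ c d s :=
  velocityOn_eq_of_hasMFDerivWithinAt hcd hs
    (((hγ s (Icc_subset_Icc hc hd hs)).mdifferentiableWithinAt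
      (by simp)).hasMFDerivWithinAt.mono (Icc_subset_Icc hc hd))

variable [IsManifold 𝓘(ℝ, E) ∞ M]

/-- The velocity of a smooth curve is smooth, up to the end points of the interval. -/
lemma contMDiffOn_velocityOn (hcd : c < d)
    (hγ : ContMDiffOn 𝓘(ℝ, ℝ) 𝓘(ℝ, E) ∞ γ (Icc c d)) :
    ContMDiffOn 𝓘(ℝ, ℝ) (𝓘(ℝ, E).prod 𝓘(ℝ, E)) ∞
      (fun s : ℝ ↦ (Bundle.TotalSpace.mk' E (γ s) (velocityOn γ c d s) :
        TangentBundle 𝓘(ℝ, E) M)) (Icc c d) := by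
  have h1 := hγ.contMDiffOn_tangentMapWithin (m := ∞) (by simp)
    (uniqueDiffOn_Icc hcd).uniqueMDiffOn
  have h2 : ContMDiff 𝓘(ℝ, ℝ) (𝓘(ℝ, ℝ).prod 𝓘(ℝ, ℝ)) ∞
      (fun y : ℝ ↦ (Bundle.TotalSpace.mk' ℝ y (1 : ℝ) : TangentBundle 𝓘(ℝ, ℝ) ℝ)) := by
    intro y
    refine Bundle.contMDiffAt_totalSpace.2 ⟨contMDiffAt_id, ?_⟩
    simpa using contMDiffAt_const
  exact h1.comp (h2.contMDiffOn (s := Icc c d)) (fun y hy ↦ hy)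

lemma OneForm.continuousOn_velocityOn (θ : OneForm E M) (hcd : c < d)
    (hγ : ContMDiffOn 𝓘(ℝ, ℝ) 𝓘(ℝ, E) ∞ γ (Icc c d)) :
    ContinuousOn (fun s ↦ θ.toFun (γ s) (velocityOn γ c d s)) (Icc c d) := by
  have h1 := θ.smooth.comp_contMDiffOn hγ
  have h2 := ContMDiffOn.clm_bundle_apply (F₁ := E) (F₂ := ℝ)
    (E₁ := fun x : M ↦ TangentSpace 𝓘(ℝ, E) x) (E₂ := Bundle.Trivial M ℝ)
    (b := γ) h1 (contMDiffOn_velocityOn hcd hγ)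
  intro y hy
  have h3 := h2 y hy
  rw [Bundle.contMDiffWithinAt_totalSpace] at h3
  exact h3.2.continuousWithinAt

lemma OneForm.intervalIntegrable (θ : OneForm E M) (hcd : c < d)
    (hγ : ContMDiffOn 𝓘(ℝ, ℝ) 𝓘(ℝ, E) ∞ γ (Icc c d)) :
    IntervalIntegrable (fun s ↦ θ.toFun (γ s) (mfderiv 𝓘(ℝ, ℝ) 𝓘(ℝ, E) γ s (1 : ℝ)))
      MeasureTheory.volume c d := by
  have h1 : IntervalIntegrable (fun s ↦ θ.toFun (γ s) (velocityOn γ c d s))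
      MeasureTheory.volume c d :=
    ContinuousOn.intervalIntegrable (by
      rw [uIcc_of_le hcd.le]; exact θ.continuousOn_velocityOn hcd hγ)
  rw [intervalIntegrable_iff_integrableOn_Ioo_of_le hcd.le] at h1 ⊢
  refine h1.congr_fun (fun s hs ↦ ?_) measurableSet_Ioo
  exact congrArg (θ.toFun (γ s)) (velocityOn_eq_mfderiv hs)

lemma OneForm.curveIntegral_congr (θ : OneForm E M) (hcd : c ≤ d) (h : EqOn γ γ' (Ioo c d)) :
    θ.curveIntegral γ c d = θ.curveIntegral γ' c d := by
  refine intervalIntegral.integral_congr_Ioo_of_le hcd fun s hs ↦ ?_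
  have h1 : γ =ᶠ[𝓝 s] γ' := h.eventuallyEq_of_mem (Ioo_mem_nhds hs.1 hs.2)
  have h2 : (mfderiv 𝓘(ℝ, ℝ) 𝓘(ℝ, E) γ s : ℝ →L[ℝ] E) = mfderiv 𝓘(ℝ, ℝ) 𝓘(ℝ, E) γ' s :=
    h1.mfderiv_eq
  have h3 := θ.toFun_congr_point (h hs) (mfderiv 𝓘(ℝ, ℝ) 𝓘(ℝ, E) γ s (1 : ℝ))
  refine h3.trans ?_
  exact congrArg (fun L : ℝ →L[ℝ] E ↦ θ.toFun (γ' s) (L 1)) h2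

end Velocity

/-! ### Straight segments in charts -/

section Line

/-- The curve which, in the preferred chart at `x₀`, starts at `y` at the time `c` and moves along
a straight line with constant velocity `w`. -/
noncomputable def chartLine (x₀ : M) (y w : E) (c s : ℝ) : M :=
  (extChartAt 𝓘(ℝ, E) x₀).symm (y + (s - c) • w)

variable {x₀ : M} {y w : E} {c d s : ℝ}

@[simp] lemma chartLine_self : chartLine x₀ y w c c = (extChartAt 𝓘(ℝ, E) x₀).symm y := by
  simp [chartLine]

variable [IsManifold 𝓘(ℝ, E) ∞ M]

lemma hasMFDerivAt_chartLine (hs : y + (s - c) • w ∈ (extChartAt 𝓘(ℝ, E) x₀).target) :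
    HasMFDerivAt 𝓘(ℝ, ℝ) 𝓘(ℝ, E) (chartLine x₀ y w c) s
      ((chartSymmDeriv x₀ (y + (s - c) • w)).comp
        (ContinuousLinearMap.toSpanSingleton ℝ w) : ℝ →L[ℝ] E) := by
  have h1 : HasDerivAt (fun s : ℝ ↦ y + (s - c) • w) w s := by
    simpa using (((hasDerivAt_id s).sub_const c).smul_const w).const_add y
  exact (hasMFDerivAt_chart_symm hs).comp s h1.hasFDerivAt.hasMFDerivAt

lemma contMDiffOn_chartLine
    (h : ∀ s ∈ Icc c d, y + (s - c) • w ∈ (extChartAt 𝓘(ℝ, E) x₀).target) :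
    ContMDiffOn 𝓘(ℝ, ℝ) 𝓘(ℝ, E) ∞ (chartLine x₀ y w c) (Icc c d) := by
  have h1 : ContDiff ℝ ∞ (fun s : ℝ ↦ y + (s - c) • w) := by fun_prop
  exact (contMDiffOn_chart_symm x₀).comp h1.contMDiff.contMDiffOn h

lemma velocityOn_chartLine (hs : s ∈ Icc c d) (hcd : c < d)
    (h : y + (s - c) • w ∈ (extChartAt 𝓘(ℝ, E) x₀).target) :
    (velocityOn (chartLine x₀ y w c) c d s : E) = chartSymmDeriv x₀ (y + (s - c) • w) w := by
  rw [velocityOn_eq_of_hasMFDerivWithinAt hcd hs (hasMFDerivAt_chartLine h).hasMFDerivWithinAt]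
  exact congrArg (chartSymmDeriv x₀ (y + (s - c) • w)) (one_smul ℝ w)

lemma OneForm.curveIntegral_chartLine (θ : OneForm E M) (hcd : c ≤ d)
    (h : ∀ s ∈ Icc c d, y + (s - c) • w ∈ (extChartAt 𝓘(ℝ, E) x₀).target) :
    θ.curveIntegral (chartLine x₀ y w c) c d
      = ∫ s in c..d, θ.chartForm x₀ (y + (s - c) • w) w := by
  refine intervalIntegral.integral_congr_Ioo_of_le hcd fun s hs ↦ ?_
  have h1 := (hasMFDerivAt_chartLine (h s ⟨hs.1.le, hs.2.le⟩)).mfderiv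
  have h2 := congrArg (fun L : ℝ →L[ℝ] E ↦ θ.toFun (chartLine x₀ y w c s) (L 1)) h1
  exact h2.trans (congrArg (θ.chartForm x₀ (y + (s - c) • w)) (one_smul ℝ w))

end Line

end WeylSpaceTime

namespace WeylSpaceTime

variable {E : Type*} [NormedAddCommGroup E] [NormedSpace ℝ E]
  {M : Type*}

/-! ### Cutting and prolonging time-like curves -/

/-- The curve which follows `γ` up to the time `b` and `σ` from then on. -/
noncomputable def concat (γ : ℝ → M) (b : ℝ) (σ : ℝ → M) (s : ℝ) : M :=
  if s ≤ b then γ s else σ s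

section Concat

variable {γ σ : ℝ → M} {a b d : ℝ}

lemma eqOn_concat_left : EqOn (concat γ b σ) γ (Iic b) := fun _ hs ↦ if_pos hs

lemma eqOn_concat_right (h : σ b = γ b) : EqOn (concat γ b σ) σ (Ici b) := by
  intro s hs
  rcases (mem_Ici.1 hs).eq_or_lt with rfl | hs
  · rw [concat, if_pos le_rfl, h]
  · exact if_neg (not_le.2 hs)

end Concat

variable [TopologicalSpace M] [ChartedSpace E M] [IsManifold 𝓘(ℝ, E) ∞ M]

namespace LorentzMetric

variable (g : LorentzMetric E M)

/-- `γ` is smooth on `[c, d]` with time-like velocity. -/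
def IsTimelikePiece (γ : ℝ → M) (c d : ℝ) : Prop :=
  ContMDiffOn 𝓘(ℝ, ℝ) 𝓘(ℝ, E) ∞ γ (Icc c d) ∧
    ∀ s ∈ Icc c d, g.toFun (γ s) (velocityOn γ c d s) (velocityOn γ c d s) < 0

/-- `γ` restricted to `[a, b]` is a piecewise smooth time-like curve admitting a subdivision whose
last piece is `[m, b]`. -/
def IsTimelikeFrom (γ : ℝ → M) (a m b : ℝ) : Prop :=
  ∃ (n : ℕ) (t : ℕ → ℝ), t 0 = a ∧ t n = m ∧ t (n + 1) = b ∧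
    (∀ i ≤ n, t i < t (i + 1)) ∧
    (∀ i ≤ n, g.IsTimelikePiece γ (t i) (t (i + 1))) ∧
    (∀ i < n, g.toFun (γ (t (i + 1))) (velocityOn γ (t i) (t (i + 1)) (t (i + 1)))
      (velocityOn γ (t (i + 1)) (t (i + 2)) (t (i + 1))) < 0)

variable {g} {γ γ' σ : ℝ → M} {a m b c d : ℝ}

lemma isTimelikeCurve_iff_exists : g.IsTimelikeCurve γ a b ↔ ∃ m, g.IsTimelikeFrom γ a m b := by
  constructor
  · rintro ⟨n, t, h0, h1, hlt, hs, hv, hb⟩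
    exact ⟨t n, n, t, h0, rfl, h1, hlt, fun i hi ↦ ⟨hs i hi, hv i hi⟩, hb⟩
  · rintro ⟨m, n, t, h0, -, h1, hlt, hp, hb⟩
    exact ⟨n, t, h0, h1, hlt, fun i hi ↦ (hp i hi).1, fun i hi ↦ (hp i hi).2, hb⟩

lemma IsTimelikePiece.congr (h : g.IsTimelikePiece γ c d) (hγ : EqOn γ' γ (Icc c d)) :
    g.IsTimelikePiece γ' c d := by
  refine ⟨h.1.congr hγ, fun s hs ↦ ?_⟩
  have h1 := h.2 s hs
  have h2 := velocityOn_congr (E := E) hγ hs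
  have h3 := g.toFun_congr_point (hγ hs) (velocityOn (E := E) γ' c d s)
    (velocityOn (E := E) γ' c d s)
  refine h3.trans_lt ?_
  rw [h2]
  exact h1

lemma IsTimelikePiece.mono (h : g.IsTimelikePiece γ m b) (hc : m < c) (hcb : c ≤ b) :
    g.IsTimelikePiece γ m c := by
  refine ⟨h.1.mono (Icc_subset_Icc_right hcb), fun s hs ↦ ?_⟩
  rw [velocityOn_of_subset le_rfl hc hcb hs h.1]
  exact h.2 s (Icc_subset_Icc_right hcb hs)

lemma IsTimelikePiece.isTimelikeFrom (h : g.IsTimelikePiece γ a b) (hab : a < b) :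
    g.IsTimelikeFrom γ a a b := by
  refine ⟨0, fun i ↦ if i = 0 then a else b, by simp, by simp, by simp, fun i hi ↦ ?_,
    fun i hi ↦ ?_, fun i hi ↦ absurd hi (Nat.not_lt_zero i)⟩
  all_goals
    obtain rfl : i = 0 := Nat.le_zero.1 hi
    simpa

lemma le_of_subdivision {t : ℕ → ℝ} {n : ℕ} (hlt : ∀ i ≤ n, t i < t (i + 1)) {i j : ℕ}
    (hij : i ≤ j) (hj : j ≤ n + 1) : t i ≤ t j := by
  induction j, hij using Nat.le_induction with
  | base => exact le_rfl
  | succ k _ ih => exact (ih (by omega)).trans (hlt k (by omega)).le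

lemma IsTimelikeFrom.left_le (h : g.IsTimelikeFrom γ a m b) : a ≤ m := by
  obtain ⟨n, t, rfl, rfl, -, hlt, -⟩ := h
  exact le_of_subdivision hlt (Nat.zero_le n) (Nat.le_succ n)

lemma IsTimelikeFrom.lt_right (h : g.IsTimelikeFrom γ a m b) : m < b := by
  obtain ⟨n, t, -, rfl, rfl, hlt, -⟩ := h
  exact hlt n le_rfl

lemma IsTimelikeFrom.lastPiece (h : g.IsTimelikeFrom γ a m b) : g.IsTimelikePiece γ m b := by
  obtain ⟨n, t, -, rfl, rfl, -, hp, -⟩ := h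
  exact hp n le_rfl

/-- Restriction of a time-like curve to a shorter interval ending inside the last piece. -/
lemma IsTimelikeFrom.truncate (h : g.IsTimelikeFrom γ a m b) (hc : m < c) (hcb : c ≤ b) :
    g.IsTimelikeFrom γ a m c := by
  obtain ⟨n, t, rfl, rfl, rfl, hlt, hp, hb⟩ := h
  have ht : ∀ i ≤ n, (Function.update t (n + 1) c) i = t i := fun i hi ↦
    Function.update_of_ne (by omega) _ _
  have ht' : (Function.update t (n + 1) c) (n + 1) = c := Function.update_self _ _ _
  set t' := Function.update t (n + 1) c
  refine ⟨n, t', ht 0 (Nat.zero_le n), ht n le_rfl, ht', fun i hi ↦ ?_, fun i hi ↦ ?_,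
    fun i hi ↦ ?_⟩
  · rcases hi.eq_or_lt with rfl | hi
    · rwa [ht i le_rfl, ht']
    · rw [ht i hi.le, ht (i + 1) hi]
      exact hlt i hi.le
  · rcases hi.eq_or_lt with rfl | hi
    · rw [ht i le_rfl, ht']
      exact (hp i le_rfl).mono hc hcb
    · rw [ht i hi.le, ht (i + 1) hi]
      exact hp i hi.le
  · rw [ht i hi.le, ht (i + 1) hi]
    rcases (Nat.succ_le_of_lt hi).eq_or_lt with hi' | hi'
    · obtain rfl : i + 1 = n := hi'
      rw [show i + 2 = i + 1 + 1 from rfl, ht',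
        velocityOn_of_subset le_rfl hc hcb ⟨le_rfl, hc.le⟩ (hp (i + 1) le_rfl).1]
      exact hb i hi
    · rw [ht (i + 2) hi']
      exact hb i hi

/-- Prolongation of a time-like curve by a smooth one which starts in the same time cone. -/
lemma IsTimelikeFrom.concat (h : g.IsTimelikeFrom γ a m b) (hbd : b < d)
    (hσ : g.IsTimelikePiece σ b d) (hσb : σ b = γ b)
    (hcone : g.toFun (γ b) (velocityOn γ m b b : E) (velocityOn σ b d b : E) < 0) :
    g.IsTimelikeFrom (concat γ b σ) a b d := by
  obtain ⟨n, t, rfl, rfl, rfl, hlt, hp, hb⟩ := h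
  have ht : ∀ i ≤ n + 1, (Function.update t (n + 2) d) i = t i := fun i hi ↦
    Function.update_of_ne (by omega) _ _
  have ht' : (Function.update t (n + 2) d) (n + 2) = d := Function.update_self _ _ _
  set t' := Function.update t (n + 2) d
  have hleft : ∀ i ≤ n, EqOn (WeylSpaceTime.concat γ (t (n + 1)) σ) γ (Icc (t i) (t (i + 1))) :=
    fun i hi s hs ↦ eqOn_concat_left (hs.2.trans (le_of_subdivision hlt (by omega) le_rfl))
  have hright : EqOn (WeylSpaceTime.concat γ (t (n + 1)) σ) σ (Icc (t (n + 1)) d) :=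
    fun s hs ↦ eqOn_concat_right hσb hs.1
  refine ⟨n + 1, t', ht 0 (Nat.zero_le _), ht (n + 1) le_rfl, ht', fun i hi ↦ ?_, fun i hi ↦ ?_,
    fun i hi ↦ ?_⟩
  · rcases hi.eq_or_lt with rfl | hi
    · rwa [ht (n + 1) le_rfl, ht']
    · rw [ht i hi.le, ht (i + 1) hi]
      exact hlt i (Nat.lt_succ_iff.1 hi)
  · rcases hi.eq_or_lt with rfl | hi
    · rw [ht (n + 1) le_rfl, ht']
      exact hσ.congr hright
    · rw [ht i hi.le, ht (i + 1) hi]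
      exact (hp i (Nat.lt_succ_iff.1 hi)).congr (hleft i (Nat.lt_succ_iff.1 hi))
  · rw [ht i hi.le, ht (i + 1) hi]
    have hin : i ≤ n := Nat.lt_succ_iff.1 hi
    have hvl := velocityOn_congr (E := E) (hleft i hin) (right_mem_Icc.2 (hlt i hin).le)
    refine (g.toFun_congr_point (hleft i hin (right_mem_Icc.2 (hlt i hin).le)) _ _).trans_lt ?_
    rcases hin.eq_or_lt with rfl | hi'
    · have hvr := velocityOn_congr (E := E) hright (left_mem_Icc.2 hbd.le)
      rw [hvl, ht', hvr]
      exact hcone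
    · have hvr := velocityOn_congr (E := E) (hleft (i + 1) hi')
        (left_mem_Icc.2 (hlt (i + 1) hi').le)
      rw [hvl, ht (i + 2) (by omega), hvr]
      exact hb i hi'

lemma IsTimelikeFrom.intervalIntegrable (h : g.IsTimelikeFrom γ a m b) (θ : OneForm E M) :
    IntervalIntegrable (fun s ↦ θ.toFun (γ s) (mfderiv 𝓘(ℝ, ℝ) 𝓘(ℝ, E) γ s (1 : ℝ)))
      MeasureTheory.volume a b := by
  obtain ⟨n, t, rfl, -, rfl, hlt, hp, -⟩ := h
  exact IntervalIntegrable.trans_iterate fun k hk ↦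
    θ.intervalIntegrable (hlt k (Nat.lt_succ_iff.1 hk)) (hp k (Nat.lt_succ_iff.1 hk)).1

lemma IsTimelikeFrom.curveIntegral_concat (h : g.IsTimelikeFrom γ a m b) (hbd : b < d)
    (hσ : g.IsTimelikePiece σ b d) (hσb : σ b = γ b)
    (hcone : g.toFun (γ b) (velocityOn γ m b b : E) (velocityOn σ b d b : E) < 0)
    (θ : OneForm E M) :
    θ.curveIntegral (WeylSpaceTime.concat γ b σ) a d
      = θ.curveIntegral γ a b + θ.curveIntegral σ b d := by
  have hab : a ≤ b := h.left_le.trans h.lt_right.le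
  have h1 : θ.curveIntegral γ a b = θ.curveIntegral (WeylSpaceTime.concat γ b σ) a b :=
    θ.curveIntegral_congr hab fun s hs ↦ (eqOn_concat_left hs.2.le).symm
  have h2 : θ.curveIntegral σ b d = θ.curveIntegral (WeylSpaceTime.concat γ b σ) b d :=
    θ.curveIntegral_congr hbd.le fun s hs ↦ (eqOn_concat_right hσb hs.1.le).symm
  have h3 := h.concat hbd hσ hσb hcone
  have h4 := h3.intervalIntegrable θ
  rw [h1, h2]
  symm
  refine intervalIntegral.integral_add_adjacent_intervals (h4.mono_set ?_) (h4.mono_set ?_)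
  · rw [uIcc_of_le hab, uIcc_of_le (hab.trans hbd.le)]
    exact Icc_subset_Icc_right hbd.le
  · rw [uIcc_of_le hbd.le, uIcc_of_le (hab.trans hbd.le)]
    exact Icc_subset_Icc_left hab

end LorentzMetric

end WeylSpaceTime

namespace WeylSpaceTime

variable {E : Type*} [NormedAddCommGroup E] [NormedSpace ℝ E]
  {M : Type*} [TopologicalSpace M] [ChartedSpace E M] [IsManifold 𝓘(ℝ, E) ∞ M]

/-! ### Uniform time cones in charts -/

namespace LorentzMetric

variable {g : LorentzMetric E M} {γ : ℝ → M} {a m b c T ρ δ : ℝ} {x₀ : M} {y z w e : E}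

variable (g) in
/-- In the preferred chart at `x₀`, all the vectors of the ball of radius `δ` around `e` are
time-like and in the same time cone at all the points of the ball of radius `ρ` around `x₀`. -/
structure IsUniformCone (x₀ : M) (e : E) (ρ δ : ℝ) : Prop where
  radius_pos : 0 < ρ
  aperture_pos : 0 < δ
  ball_subset : Metric.ball (extChartAt 𝓘(ℝ, E) x₀ x₀) ρ ⊆ (extChartAt 𝓘(ℝ, E) x₀).target
  neg : ∀ y ∈ Metric.ball (extChartAt 𝓘(ℝ, E) x₀ x₀) ρ, ∀ w ∈ Metric.ball e δ,
    ∀ w' ∈ Metric.ball e δ, g.chartMetric x₀ y w w' < 0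

lemma chartMetric_self (g : LorentzMetric E M) (x₀ : M) (v w : E) :
    g.chartMetric x₀ (extChartAt 𝓘(ℝ, E) x₀ x₀) v w = g.toFun x₀ (v : E) (w : E) := by
  rw [LorentzMetric.chartMetric_apply, chartSymmDeriv_self, chartSymmDeriv_self]
  exact g.toFun_congr_point (extChartAt_to_inv x₀) v w

lemma exists_isUniformCone [FiniteDimensional ℝ E]
    (he : g.chartMetric x₀ (extChartAt 𝓘(ℝ, E) x₀ x₀) e e < 0) {N : Set E}
    (hN : N ∈ 𝓝 (extChartAt 𝓘(ℝ, E) x₀ x₀)) :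
    ∃ ρ δ, g.IsUniformCone x₀ e ρ δ ∧ Metric.ball (extChartAt 𝓘(ℝ, E) x₀ x₀) ρ ⊆ N := by
  set y₀ := extChartAt 𝓘(ℝ, E) x₀ x₀ with hy₀
  have htarget := extChartAt_target_mem_nhds (I := 𝓘(ℝ, E)) x₀
  have hG : ContinuousAt (g.chartMetric x₀) y₀ :=
    (g.continuousOn_chartMetric x₀).continuousAt htarget
  have hcont : ContinuousAt (fun q : E × E × E ↦ g.chartMetric x₀ q.1 q.2.1 q.2.2) (y₀, e, e) := by
    have h1 : ContinuousAt (fun q : E × E × E ↦ g.chartMetric x₀ q.1) (y₀, e, e) :=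
      ContinuousAt.comp (g := g.chartMetric x₀) (f := Prod.fst) (x := (y₀, e, e)) hG continuousAt_fst
    exact (h1.clm_apply (by fun_prop)).clm_apply (by fun_prop)
  have hev := hcont.eventually_lt continuousAt_const he
  obtain ⟨δ, hδ, hev⟩ := Metric.eventually_nhds_iff_ball.1 hev
  obtain ⟨r, hr, hrN⟩ := Metric.mem_nhds_iff.1 (Filter.inter_mem htarget hN)
  have hsub : Metric.ball y₀ (min r δ) ⊆ Metric.ball y₀ r :=
    Metric.ball_subset_ball (min_le_left _ _)
  refine ⟨min r δ, δ, ⟨lt_min hr hδ, hδ, fun y hy ↦ (hrN (hsub hy)).1,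
    fun y hy w hw w' hw' ↦ hev (y, w, w') ?_⟩, fun y hy ↦ (hrN (hsub hy)).2⟩
  simp only [Metric.mem_ball, Prod.dist_eq, max_lt_iff] at hy hw hw' ⊢
  exact ⟨hy.trans_le (min_le_right _ _), hw, hw'⟩

/-- The straight segment from `z` to `z + T • w` is time-like in the chart at `x₀`. -/
def IsTimelikeSegment (g : LorentzMetric E M) (x₀ : M) (z w : E) (T : ℝ) : Prop :=
  ∀ s ∈ Icc (0 : ℝ) T, z + s • w ∈ (extChartAt 𝓘(ℝ, E) x₀).target ∧
    g.chartMetric x₀ (z + s • w) w w < 0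

lemma IsUniformCone.isTimelikeSegment (h : g.IsUniformCone x₀ e ρ δ)
    (hz : z ∈ Metric.ball (extChartAt 𝓘(ℝ, E) x₀ x₀) ρ) (hw : w ∈ Metric.ball e δ)
    (hzT : z + T • w ∈ Metric.ball (extChartAt 𝓘(ℝ, E) x₀ x₀) ρ) :
    g.IsTimelikeSegment x₀ z w T := by
  intro s hs
  have hmem := add_smul_mem_of_convex (convex_ball _ _) hz hzT hs
  exact ⟨h.ball_subset hmem, h.neg _ hmem w hw w hw⟩

lemma sub_mem_Icc_zero {s : ℝ} (hs : s ∈ Icc c (c + T)) : s - c ∈ Icc (0 : ℝ) T :=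
  ⟨sub_nonneg.2 hs.1, by linarith [hs.2]⟩

lemma IsTimelikeSegment.isTimelikePiece (h : g.IsTimelikeSegment x₀ z w T) (hT : 0 < T) (c : ℝ) :
    g.IsTimelikePiece (chartLine x₀ z w c) c (c + T) := by
  refine ⟨contMDiffOn_chartLine fun s hs ↦ (h _ (sub_mem_Icc_zero hs)).1, fun s hs ↦ ?_⟩
  rw [velocityOn_chartLine hs (by linarith) (h _ (sub_mem_Icc_zero hs)).1]
  exact (h _ (sub_mem_Icc_zero hs)).2

lemma IsTimelikeSegment.curveIntegral (h : g.IsTimelikeSegment x₀ z w T) (hT : 0 < T) (c : ℝ)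
    (θ : OneForm E M) :
    θ.curveIntegral (chartLine x₀ z w c) c (c + T)
      = ∫ s in (0 : ℝ)..T, θ.chartForm x₀ (z + s • w) w := by
  rw [θ.curveIntegral_chartLine (by linarith) fun s hs ↦ (h _ (sub_mem_Icc_zero hs)).1]
  have := intervalIntegral.integral_comp_sub_right (a := c) (b := c + T)
    (fun s ↦ θ.chartForm x₀ (z + s • w) w) c
  rw [this, sub_self, add_sub_cancel_left]

/-- A time-like curve can be prolonged by a time-like segment of a chart which leaves in the time
cone in which the curve arrives. -/
lemma IsTimelikeFrom.exists_extend (h : g.IsTimelikeFrom γ a m b)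
    (hγb : γ b = (extChartAt 𝓘(ℝ, E) x₀).symm z) (hT : 0 < T)
    (hseg : g.IsTimelikeSegment x₀ z w T)
    (hcone : g.toFun (γ b) (velocityOn γ m b b : E) (chartSymmDeriv x₀ z w : E) < 0) :
    ∃ γ' : ℝ → M, g.IsTimelikeFrom γ' a b (b + T) ∧ γ' a = γ a ∧
      γ' (b + T) = (extChartAt 𝓘(ℝ, E) x₀).symm (z + T • w) ∧
      (velocityOn γ' b (b + T) (b + T) : E) = chartSymmDeriv x₀ (z + T • w) w ∧
      ∀ θ : OneForm E M, θ.curveIntegral γ' a (b + T) = θ.curveIntegral γ a b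
        + ∫ s in (0 : ℝ)..T, θ.chartForm x₀ (z + s • w) w := by
  have hσ := hseg.isTimelikePiece hT b
  have hσb : chartLine x₀ z w b b = γ b := by rw [chartLine_self, hγb]
  have hbT : b < b + T := by linarith
  have hv : (velocityOn (chartLine x₀ z w b) b (b + T) b : E) = chartSymmDeriv x₀ z w := by
    rw [velocityOn_chartLine ⟨le_rfl, hbT.le⟩ hbT] <;> rw [sub_self, zero_smul, add_zero]
    simpa using (hseg 0 ⟨le_rfl, hT.le⟩).1
  rw [← hv] at hcone
  have hright : EqOn (WeylSpaceTime.concat γ b (chartLine x₀ z w b)) (chartLine x₀ z w b)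
      (Icc b (b + T)) := fun s hs ↦ eqOn_concat_right hσb hs.1
  refine ⟨WeylSpaceTime.concat γ b (chartLine x₀ z w b), h.concat hbT hσ hσb hcone,
    eqOn_concat_left (h.left_le.trans h.lt_right.le), ?_, ?_, fun θ ↦ ?_⟩
  · rw [hright ⟨hbT.le, le_rfl⟩, chartLine, add_sub_cancel_left]
  · rw [velocityOn_congr hright ⟨hbT.le, le_rfl⟩, velocityOn_chartLine ⟨hbT.le, le_rfl⟩ hbT] <;>
      rw [add_sub_cancel_left]
    exact (hseg T ⟨hT.le, le_rfl⟩).1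
  · rw [h.curveIntegral_concat hbT hσ hσb hcone, hseg.curveIntegral hT]

/-- Near the end point `γ b` of a time-like curve, in the chart at that point, a time-like curve
with the same origin ends at every point, with a velocity close to the final velocity of `γ`:
a short final part of `γ` is replaced by a straight segment. -/
lemma IsTimelikeFrom.exists_reach [FiniteDimensional ℝ E] (h : g.IsTimelikeFrom γ a m b) :
    ∃ e ρ δ, g.IsUniformCone (γ b) e ρ δ ∧ ∃ r > 0, r ≤ ρ ∧
      ∀ y ∈ Metric.ball (extChartAt 𝓘(ℝ, E) (γ b) (γ b)) r,
        ∃ (γ' : ℝ → M) (m' b' : ℝ) (w : E), g.IsTimelikeFrom γ' a m' b' ∧ γ' a = γ a ∧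
          γ' b' = (extChartAt 𝓘(ℝ, E) (γ b)).symm y ∧ w ∈ Metric.ball e δ ∧
          (velocityOn γ' m' b' b' : E) = chartSymmDeriv (γ b) y w := by
  set q := γ b with hq
  set φ := extChartAt 𝓘(ℝ, E) q with hφ
  have hmb := h.lt_right
  have hsmooth := h.lastPiece.1
  -- a final part of `γ` stays in the domain of the chart
  obtain ⟨m₁, hm₁, hm₁b, hsource⟩ : ∃ m₁, m ≤ m₁ ∧ m₁ < b ∧ ∀ s ∈ Icc m₁ b, γ s ∈ φ.source := by
    have h1 : γ ⁻¹' φ.source ∈ 𝓝[Icc m b] b :=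
      (hsmooth b ⟨hmb.le, le_rfl⟩).continuousWithinAt (extChartAt_source_mem_nhds q)
    rw [nhdsWithin_Icc_eq_nhdsLE hmb] at h1
    obtain ⟨l, hl, hls⟩ := (mem_nhdsLE_iff_exists_Icc_subset).1 h1
    exact ⟨max l m, le_max_right _ _, max_lt hl hmb,
      fun s hs ↦ hls ⟨(le_max_left _ _).trans hs.1, hs.2⟩⟩
  have hsmooth₁ : ContMDiffOn 𝓘(ℝ, ℝ) 𝓘(ℝ, E) ∞ γ (Icc m₁ b) :=
    hsmooth.mono (Icc_subset_Icc_left hm₁)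
  set u : ℝ → E := fun s ↦ φ (γ s) with hu
  have hudiff : ContDiffOn ℝ ∞ u (Icc m₁ b) := by
    rw [← contMDiffOn_iff_contDiffOn]
    have h1 : ContMDiffOn 𝓘(ℝ, E) 𝓘(ℝ, E) ∞ φ φ.source := by
      rw [hφ, extChartAt_source]
      exact contMDiffOn_extChartAt
    exact h1.comp hsmooth₁ hsource
  set u' : ℝ → E := derivWithin u (Icc m₁ b) with hu'
  have hucont : ContinuousOn u' (Icc m₁ b) :=
    hudiff.continuousOn_derivWithin (uniqueDiffOn_Icc hm₁b) (by simp)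
  have hderiv : ∀ s ∈ Icc m₁ b, HasDerivWithinAt u (u' s) (Icc m₁ b) s := fun s hs ↦
    ((hudiff.differentiableOn (by simp)) s hs).hasDerivWithinAt
  have hγu : ∀ s ∈ Icc m₁ b, φ.symm (u s) = γ s := fun s hs ↦ φ.left_inv (hsource s hs)
  have hutarget : ∀ s ∈ Icc m₁ b, u s ∈ φ.target := fun s hs ↦ φ.map_source (hsource s hs)
  have hvel : ∀ s, m₁ < s → s ≤ b →
      (velocityOn γ m s s : E) = chartSymmDeriv q (u s) (u' s) := by
    intro s hs hsb
    have hs' : s ∈ Icc m₁ b := ⟨hs.le, hsb⟩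
    have h1 : HasMFDerivWithinAt 𝓘(ℝ, ℝ) 𝓘(ℝ, E) (fun t ↦ φ.symm (u t)) (Icc m₁ s) s
        ((chartSymmDeriv q (u s)).comp
          (ContinuousLinearMap.toSpanSingleton ℝ (u' s)) : ℝ →L[ℝ] E) :=
      (hasMFDerivAt_chart_symm (hutarget s hs')).comp_hasMFDerivWithinAt s
        (((hderiv s hs').mono (Icc_subset_Icc_right hsb)).hasFDerivWithinAt.hasMFDerivWithinAt)
    have h2 : EqOn γ (fun t ↦ φ.symm (u t)) (Icc m₁ s) :=
      fun t ht ↦ (hγu t ⟨ht.1, ht.2.trans hsb⟩).symm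
    have h3 := velocityOn_eq_of_hasMFDerivWithinAt hs ⟨hs.le, le_rfl⟩ h1
    rw [← velocityOn_of_subset hm₁ hs le_rfl ⟨hs.le, le_rfl⟩
      (hsmooth.mono (Icc_subset_Icc_right hsb)), velocityOn_congr h2 ⟨hs.le, le_rfl⟩, h3]
    exact congrArg (chartSymmDeriv q (u s)) (one_smul ℝ (u' s))
  have hbmem : b ∈ Icc m₁ b := ⟨hm₁b.le, le_rfl⟩
  set e := u' b with he
  have hvb : (velocityOn γ m b b : E) = e := by
    rw [hvel b hm₁b le_rfl]
    exact chartSymmDeriv_self q e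
  have hneg : g.chartMetric q (φ q) e e < 0 := by
    have h1 := h.lastPiece.2 b ⟨hmb.le, le_rfl⟩
    rw [hvel b hm₁b le_rfl] at h1
    refine lt_of_eq_of_lt ?_ h1
    exact g.toFun_congr_point (hγu b hbmem) _ _
  obtain ⟨ρ, δ, hcone, -⟩ := exists_isUniformCone hneg Filter.univ_mem
  refine ⟨e, ρ, δ, hcone, ?_⟩
  -- the time at which `γ` is left is chosen close to `b`
  obtain ⟨c, ⟨hc, hcb⟩, hcρ, hcδ, hcslope⟩ : ∃ c ∈ Ioo m₁ b, u c ∈ Metric.ball (φ q) ρ ∧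
      u' c ∈ Metric.ball e δ ∧ slope u b c ∈ Metric.ball e (δ / 2) := by
    have hle : 𝓝[<] b ≤ 𝓝[Icc m₁ b] b := by
      rw [nhdsWithin_Icc_eq_nhdsLE hm₁b]
      exact nhdsWithin_mono b Iio_subset_Iic_self
    have h1 := ((hudiff.continuousOn b hbmem).mono_left hle).eventually
      (Metric.ball_mem_nhds (u b) hcone.radius_pos)
    have h2 := ((hucont b hbmem).mono_left hle).eventually
      (Metric.ball_mem_nhds (u' b) hcone.aperture_pos)
    have h3 := ((hasDerivWithinAt_iff_tendsto_slope.1 (hderiv b hbmem)).mono_left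
      (nhdsWithin_le_of_mem (Filter.mem_of_superset (Ioo_mem_nhdsLT hm₁b)
        fun s hs ↦ ⟨⟨hs.1.le, hs.2.le⟩, hs.2.ne⟩))).eventually
      (Metric.ball_mem_nhds (u' b) (half_pos hcone.aperture_pos))
    have h0 : ∀ᶠ s in 𝓝[<] b, s ∈ Ioo m₁ b := Ioo_mem_nhdsLT hm₁b
    obtain ⟨c, hc⟩ := (h0.and (h1.and (h2.and h3))).exists
    exact ⟨c, hc.1, hc.2.1, hc.2.2.1, hc.2.2.2⟩
  set T := b - c with hT
  have hTpos : 0 < T := sub_pos.2 hcb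
  have hδ := hcone.aperture_pos
  refine ⟨min ρ (T * (δ / 2)), lt_min hcone.radius_pos (by positivity), min_le_left _ _,
    fun y hy ↦ ?_⟩
  have hyρ : y ∈ Metric.ball (φ q) ρ := Metric.ball_subset_ball (min_le_left _ _) hy
  set w : E := T⁻¹ • (y - u c) with hw
  have hwT : u c + T • w = y := by
    rw [hw, smul_smul, mul_inv_cancel₀ hTpos.ne', one_smul, add_sub_cancel]
  have hwball : w ∈ Metric.ball e δ := by
    have h1 : w - e = T⁻¹ • (y - φ q) + (slope u b c - e) := by
      rw [slope_def_module, hw, show (c - b)⁻¹ = -T⁻¹ by rw [hT, ← inv_neg, neg_sub],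
        show u b = φ q from rfl]
      module
    have h2 : ‖T⁻¹ • (y - φ q)‖ < δ / 2 := by
      have h3 : dist y (φ q) < T * (δ / 2) := hy.trans_le (min_le_right _ _)
      rw [norm_smul, norm_inv, Real.norm_of_nonneg hTpos.le, ← dist_eq_norm]
      rwa [inv_mul_lt_iff₀ hTpos]
    rw [Metric.mem_ball, dist_eq_norm] at hcslope
    rw [Metric.mem_ball, dist_eq_norm, h1]
    exact (norm_add_le _ _).trans_lt (by linarith)
  have hcmem : c ∈ Icc m₁ b := ⟨hc.le, hcb.le⟩
  have htrunc := h.truncate (hm₁.trans_lt hc) hcb.le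
  obtain ⟨γ', h1, h2, h3, h4, -⟩ := htrunc.exists_extend (hγu c hcmem).symm hTpos
    (hcone.isTimelikeSegment hcρ hwball (by rwa [hwT])) (by
      rw [hvel c hc hcb.le]
      refine lt_of_eq_of_lt ?_ (hcone.neg (u c) hcρ (u' c) hcδ w hwball)
      exact g.toFun_congr_point (hγu c hcmem).symm _ _)
  rw [hwT] at h3 h4
  exact ⟨γ', c, c + T, w, h1, h2, h3, hwball, h4⟩

end LorentzMetric

end WeylSpaceTime

namespace WeylSpaceTime

variable {E : Type*} [NormedAddCommGroup E] [NormedSpace ℝ E]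
  {M : Type*} [TopologicalSpace M] [ChartedSpace E M] [IsManifold 𝓘(ℝ, E) ∞ M]

/-! ### Primitives of 1-forms -/

namespace OneForm

variable {θ : OneForm E M} {F : M → ℝ} {U : Set M} {x₀ : M} {y z w : E} {T : ℝ}

lemma hasFDerivAt_comp_chart_symm (hy : y ∈ (extChartAt 𝓘(ℝ, E) x₀).target)
    (hF : HasMFDerivAt 𝓘(ℝ, E) 𝓘(ℝ, ℝ) F ((extChartAt 𝓘(ℝ, E) x₀).symm y)
      (θ.toFun ((extChartAt 𝓘(ℝ, E) x₀).symm y))) :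
    HasFDerivAt (F ∘ (extChartAt 𝓘(ℝ, E) x₀).symm) (θ.chartForm x₀ y) y :=
  (hF.comp y (hasMFDerivAt_chart_symm hy)).hasFDerivAt

lemma hasMFDerivAt_of_comp_chart_symm
    (hF : HasFDerivAt (F ∘ (extChartAt 𝓘(ℝ, E) x₀).symm)
      (θ.chartForm x₀ (extChartAt 𝓘(ℝ, E) x₀ x₀)) (extChartAt 𝓘(ℝ, E) x₀ x₀)) :
    HasMFDerivAt 𝓘(ℝ, E) 𝓘(ℝ, ℝ) F x₀ (θ.toFun x₀) := by
  have h1 : HasMFDerivAt 𝓘(ℝ, E) 𝓘(ℝ, E) (extChartAt 𝓘(ℝ, E) x₀) x₀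
      (ContinuousLinearMap.id ℝ E) := by
    have h := (mdifferentiableAt_extChartAt (I := 𝓘(ℝ, E)) (mem_chart_source E x₀)).hasMFDerivAt
    rw [mfderiv_extChartAt_self] at h
    exact h
  have h2 := hF.hasMFDerivAt.comp x₀ h1
  have h3 : F =ᶠ[𝓝 x₀] (F ∘ (extChartAt 𝓘(ℝ, E) x₀).symm) ∘ extChartAt 𝓘(ℝ, E) x₀ := by
    filter_upwards [extChartAt_source_mem_nhds (I := 𝓘(ℝ, E)) x₀] with x hx
    simp only [Function.comp_apply, (extChartAt 𝓘(ℝ, E) x₀).left_inv hx]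
  have h4 := h2.congr_of_eventuallyEq h3
  have h5 : (θ.chartForm x₀ (extChartAt 𝓘(ℝ, E) x₀ x₀)).comp (ContinuousLinearMap.id ℝ E)
      = (θ.toFun x₀ : E →L[ℝ] ℝ) := by
    ext v
    have h6 := θ.toFun_congr_point (extChartAt_to_inv (I := 𝓘(ℝ, E)) x₀) v
    refine Eq.trans ?_ h6
    exact congrArg (θ.toFun _) (chartSymmDeriv_self x₀ v)
  rw [← h5]
  exact h4

/-- Locally exact forms are closed, because `d ∘ d = 0`. -/
theorem IsLocallyExact.isClosedForm (h : θ.IsLocallyExact) : θ.IsClosedForm := by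
  intro x₀ y hy
  set φ := extChartAt 𝓘(ℝ, E) x₀ with hφ
  obtain ⟨U, hU, hyU, F, hF⟩ := h (φ.symm y)
  set V : Set E := φ.target ∩ φ.symm ⁻¹' U with hV
  have hVopen : IsOpen V :=
    (continuousOn_extChartAt_symm x₀).isOpen_inter_preimage (isOpen_extChartAt_target x₀) hU
  have hyV : V ∈ 𝓝 y := hVopen.mem_nhds ⟨hy, hyU⟩
  have h1 : θ.inChart x₀ =ᶠ[𝓝 y] extDeriv
      (fun x ↦ ContinuousAlternatingMap.constOfIsEmpty ℝ E (Fin 0) ((F ∘ φ.symm) x)) := by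
    filter_upwards [hyV] with z hz
    rw [extDeriv_constOfIsEmpty, (hasFDerivAt_comp_chart_symm hz.1 (hF.2 _ hz.2)).fderiv]
    rfl
  have hsmooth : ContDiffAt ℝ ∞ (F ∘ φ.symm) y := by
    rw [← contMDiffAt_iff_contDiffAt]
    exact ((hF.1 _ hyU).contMDiffAt (hU.mem_nhds hyU)).comp y
      ((contMDiffOn_chart_symm x₀ y hy).contMDiffAt ((isOpen_extChartAt_target x₀).mem_nhds hy))
  have hsmooth' : ContDiffAt ℝ ∞
      (fun x ↦ ContinuousAlternatingMap.constOfIsEmpty ℝ E (Fin 0) ((F ∘ φ.symm) x)) y :=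
    (ContinuousAlternatingMap.constOfIsEmptyLIE ℝ E ℝ (Fin 0)).contDiff.contDiffAt.comp y hsmooth
  rw [h1.extDeriv_eq, extDeriv_extDeriv_apply hsmooth' (by simpa using ENat.LEInfty.out)]

variable [FiniteDimensional ℝ E]

/-- A function whose differential is a smooth 1-form is smooth. -/
lemma isPrimitiveOn_of_hasMFDerivAt (hU : IsOpen U)
    (hF : ∀ x ∈ U, HasMFDerivAt 𝓘(ℝ, E) 𝓘(ℝ, ℝ) F x (θ.toFun x)) : θ.IsPrimitiveOn F U := by
  refine ⟨fun x hx ↦ ContMDiffAt.contMDiffWithinAt ?_, hF⟩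
  set φ := extChartAt 𝓘(ℝ, E) x with hφ
  set V : Set E := φ.target ∩ φ.symm ⁻¹' U with hV
  have hVopen : IsOpen V :=
    (continuousOn_extChartAt_symm x).isOpen_inter_preimage (isOpen_extChartAt_target x) hU
  have hderiv : ∀ y ∈ V, HasFDerivAt (F ∘ φ.symm) (θ.chartForm x y) y := fun y hy ↦
    hasFDerivAt_comp_chart_symm hy.1 (hF _ hy.2)
  have hsmooth : ContDiffOn ℝ ∞ (F ∘ φ.symm) V := by
    rw [contDiffOn_infty_iff_fderiv_of_isOpen hVopen]
    exact ⟨fun y hy ↦ (hderiv y hy).differentiableAt.differentiableWithinAt,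
      ((θ.contDiffOn_chartForm x).mono inter_subset_left).congr fun y hy ↦ (hderiv y hy).fderiv⟩
  have hxV : φ x ∈ V := by
    refine ⟨mem_extChartAt_target x, ?_⟩
    rw [mem_preimage, hφ, extChartAt_to_inv]
    exact hx
  have h1 : ContMDiffAt 𝓘(ℝ, E) 𝓘(ℝ, ℝ) ∞ (F ∘ φ.symm) (φ x) :=
    (hsmooth.contDiffAt (hVopen.mem_nhds hxV)).contMDiffAt
  refine (h1.comp x (contMDiffAt_extChartAt (I := 𝓘(ℝ, E)))).congr_of_eventuallyEq ?_
  filter_upwards [extChartAt_source_mem_nhds (I := 𝓘(ℝ, E)) x] with x' hx'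
  simp only [Function.comp_apply, hφ, (extChartAt 𝓘(ℝ, E) x).left_inv hx']

/-- The integral of a 1-form along a segment of a chart is the increment of a primitive. -/
lemma integral_chartForm_segment (hT : 0 ≤ T)
    (hseg : ∀ s ∈ Icc (0 : ℝ) T, z + s • w ∈ (extChartAt 𝓘(ℝ, E) x₀).target)
    (hF : ∀ s ∈ Icc (0 : ℝ) T, HasMFDerivAt 𝓘(ℝ, E) 𝓘(ℝ, ℝ) F
      ((extChartAt 𝓘(ℝ, E) x₀).symm (z + s • w))
      (θ.toFun ((extChartAt 𝓘(ℝ, E) x₀).symm (z + s • w)))) :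
    ∫ s in (0 : ℝ)..T, θ.chartForm x₀ (z + s • w) w
      = F ((extChartAt 𝓘(ℝ, E) x₀).symm (z + T • w)) - F ((extChartAt 𝓘(ℝ, E) x₀).symm z) := by
  have hd : ∀ s ∈ Icc (0 : ℝ) T, HasDerivAt
      (fun s : ℝ ↦ (F ∘ (extChartAt 𝓘(ℝ, E) x₀).symm) (z + s • w))
      (θ.chartForm x₀ (z + s • w) w) s := by
    intro s hs
    have h1 : HasDerivAt (fun s : ℝ ↦ z + s • w) w s := by
      simpa using ((hasDerivAt_id s).smul_const w).const_add z
    exact (hasFDerivAt_comp_chart_symm (hseg s hs) (hF s hs)).comp_hasDerivAt s h1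
  rw [intervalIntegral.integral_eq_sub_of_hasDerivAt (f := fun s : ℝ ↦
    (F ∘ (extChartAt 𝓘(ℝ, E) x₀).symm) (z + s • w))]
  · simp
  · rw [uIcc_of_le hT]
    exact hd
  · refine ContinuousOn.intervalIntegrable ?_
    rw [uIcc_of_le hT]
    exact ((θ.contDiffOn_chartForm x₀).continuousOn.comp (by fun_prop) hseg).clm_apply
      continuousOn_const

end OneForm

/-! ### The sets `I_p` -/

namespace LorentzMetric

variable {g : LorentzMetric E M} {γ : ℝ → M} {p q x₀ : M} {a b m T ρ δ : ℝ} {z w e : E}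

lemma IsTimelikeFrom.joins (h : g.IsTimelikeFrom γ a m b) (ha : γ a = p) (hb : γ b = q) :
    g.Joins γ a b p q :=
  ⟨isTimelikeCurve_iff_exists.2 ⟨m, h⟩, ha, hb⟩

lemma IsTimelikeSegment.joins (h : g.IsTimelikeSegment x₀ z w T) (hT : 0 < T) :
    g.Joins (chartLine x₀ z w 0) 0 (0 + T) ((extChartAt 𝓘(ℝ, E) x₀).symm z)
      ((extChartAt 𝓘(ℝ, E) x₀).symm (z + T • w)) :=
  ((h.isTimelikePiece hT 0).isTimelikeFrom (by linarith)).joins chartLine_self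
    (by simp [chartLine])

lemma IsUniformCone.neg_direction (h : g.IsUniformCone x₀ e ρ δ) :
    g.IsUniformCone x₀ (-e) ρ δ := by
  have hmem : ∀ w ∈ Metric.ball (-e) δ, -w ∈ Metric.ball e δ := fun w hw ↦ by
    rwa [Metric.mem_ball, ← dist_neg_neg, neg_neg]
  refine ⟨h.radius_pos, h.aperture_pos, h.ball_subset, fun y hy w hw w' hw' ↦ ?_⟩
  simpa using h.neg y hy _ (hmem w hw) _ (hmem w' hw')

variable [FiniteDimensional ℝ E]

lemma isOpen_causalSet (g : LorentzMetric E M) (p : M) : IsOpen (g.causalSet p) := by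
  refine isOpen_iff_mem_nhds.2 fun q hq ↦ ?_
  obtain ⟨γ, a, b, hγ, ha, rfl⟩ := hq
  obtain ⟨m, hm⟩ := isTimelikeCurve_iff_exists.1 hγ
  obtain ⟨e, ρ, δ, -, r, hr, -, hreach⟩ := hm.exists_reach
  filter_upwards [(continuousAt_extChartAt (I := 𝓘(ℝ, E)) (γ b)).preimage_mem_nhds
    (Metric.ball_mem_nhds _ hr), extChartAt_source_mem_nhds (I := 𝓘(ℝ, E)) (γ b)] with x hx hx'
  obtain ⟨γ', m', b', w, h1, h2, h3, -⟩ := hreach _ hx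
  rw [(extChartAt 𝓘(ℝ, E) (γ b)).left_inv hx'] at h3
  exact ⟨γ', a, b', h1.joins (h2.trans ha) h3⟩

lemma exists_isUniformCone_subset (g : LorentzMetric E M)
    {N : Set E} (hN : N ∈ 𝓝 (extChartAt 𝓘(ℝ, E) x₀ x₀)) :
    ∃ e ρ δ, g.IsUniformCone x₀ e ρ δ ∧ Metric.ball (extChartAt 𝓘(ℝ, E) x₀ x₀) ρ ⊆ N := by
  obtain ⟨e, he, -⟩ := g.signature x₀
  exact ⟨e, exists_isUniformCone ((g.chartMetric_self x₀ e e).trans_lt he) hN⟩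

/-- Every event belongs to some `I_p`: it can be reached from its immediate past. -/
lemma exists_mem_causalSet (g : LorentzMetric E M) (x : M) : ∃ p, x ∈ g.causalSet p := by
  obtain ⟨e, ρ, δ, hcone, -⟩ := g.exists_isUniformCone_subset (x₀ := x) Filter.univ_mem
  set y₀ := extChartAt 𝓘(ℝ, E) x x
  have hev : ∀ᶠ t : ℝ in 𝓝[>] 0, y₀ - t • e ∈ Metric.ball y₀ ρ := by
    have h1 : Filter.Tendsto (fun t : ℝ ↦ y₀ - t • e) (𝓝[>] 0) (𝓝 y₀) := by
      have : Continuous (fun t : ℝ ↦ y₀ - t • e) := by fun_prop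
      simpa using (this.tendsto 0).mono_left nhdsWithin_le_nhds
    exact h1.eventually (Metric.ball_mem_nhds y₀ hcone.radius_pos)
  obtain ⟨t, ht, ht0⟩ := (hev.and self_mem_nhdsWithin).exists
  have h1 := (hcone.isTimelikeSegment (T := t) ht (Metric.mem_ball_self hcone.aperture_pos) (by
    rw [sub_add_cancel]
    exact Metric.mem_ball_self hcone.radius_pos)).joins ht0
  rw [sub_add_cancel, extChartAt_to_inv] at h1
  exact ⟨_, _, _, _, h1⟩

end LorentzMetric

/-! ### The potential along time-like curves -/

namespace WeylManifold

variable {W : WeylManifold E M} {γ : ℝ → M} {p q : M}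
  {a b m T ρ δ : ℝ} {y e : E}

open Classical in
/-- The integral of the 1-form along a chosen time-like curve from `p` to `q`; zero when there is
no such curve. -/
noncomputable def potential (W : WeylManifold E M) (p q : M) : ℝ :=
  if h : q ∈ W.metric.causalSet p then
    W.form.curveIntegral h.choose h.choose_spec.choose h.choose_spec.choose_spec.choose
  else 0

lemma IsPathIndependent.potential_eq (hW : W.IsPathIndependent) (h : W.metric.Joins γ a b p q) :
    W.potential p q = W.form.curveIntegral γ a b := by
  have hq : q ∈ W.metric.causalSet p := ⟨γ, a, b, h⟩
  rw [potential, dif_pos hq]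
  exact hW p q _ _ _ _ _ _ hq.choose_spec.choose_spec.choose_spec h

variable [FiniteDimensional ℝ E]

/-- If the integral is path independent, then `ω` is the differential of the potential at every
event of `I_p`. -/
theorem IsPathIndependent.hasMFDerivAt_potential (hW : W.IsPathIndependent)
    (hq : q ∈ W.metric.causalSet p) :
    HasMFDerivAt 𝓘(ℝ, E) 𝓘(ℝ, ℝ) (W.potential p) q (W.form.toFun q) := by
  obtain ⟨γ, a, b, hγ, ha, rfl⟩ := hq
  obtain ⟨m, hm⟩ := LorentzMetric.isTimelikeCurve_iff_exists.1 hγ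
  obtain ⟨e, ρ, δ, hcone, r, hr, hrρ, hreach⟩ := hm.exists_reach
  have hsub := Metric.ball_subset_ball (x := extChartAt 𝓘(ℝ, E) (γ b) (γ b)) hrρ
  refine OneForm.hasMFDerivAt_of_comp_chart_symm
    (hasFDerivAt_of_integral_eq_on_cone (e := e) hr hcone.aperture_pos
      ((W.form.contDiffOn_chartForm (γ b)).continuousOn.mono (hsub.trans hcone.ball_subset))
      fun z hz T hT w hw hzT ↦ ?_)
  obtain ⟨γ₁, m₁, b₁, w₁, h1, h2, h3, hw₁, h4⟩ := hreach z hz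
  obtain ⟨γ₂, h5, h6, h7, -, h8⟩ := h1.exists_extend h3 hT
    (hcone.isTimelikeSegment (hsub hz) hw (hsub hzT)) (by
      rw [h4]
      refine lt_of_eq_of_lt ?_ (hcone.neg z (hsub hz) w₁ hw₁ w hw)
      exact W.metric.toFun_congr_point h3 _ _)
  rw [Function.comp_apply, Function.comp_apply, hW.potential_eq (h1.joins (h2.trans ha) h3),
    hW.potential_eq (h5.joins (h6.trans (h2.trans ha)) h7), h8, add_sub_cancel_left]

theorem IsPathIndependent.isPrimitiveOn_potential (hW : W.IsPathIndependent) (p : M) :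
    W.form.IsPrimitiveOn (W.potential p) (W.metric.causalSet p) :=
  OneForm.isPrimitiveOn_of_hasMFDerivAt
    (W.metric.isOpen_causalSet p) fun _ hq ↦ hW.hasMFDerivAt_potential hq

theorem IsPathIndependent.isLocallyExact (hW : W.IsPathIndependent) : W.form.IsLocallyExact := by
  intro x
  obtain ⟨p, hp⟩ := W.metric.exists_mem_causalSet x
  exact ⟨_, W.metric.isOpen_causalSet p, hp, _, hW.isPrimitiveOn_potential p⟩

/-- Let `γ` be a time-like curve, possibly leaving the chart domain, from `p` to an event near
`p`. If `γ` arrives in the time cone of `e`, then its prolongation in the direction of `e` ends at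
an event which is also reached from `p` by a short straight segment. By path independence, the
integral along `γ` is then the increment of any local primitive. -/
lemma IsPathIndependent.curveIntegral_eq_of_cone (hW : W.IsPathIndependent)
    (hcone : W.metric.IsUniformCone p e ρ δ) {F : M → ℝ} (hT : 0 < T)
    (hF : ∀ z ∈ Metric.ball (extChartAt 𝓘(ℝ, E) p p) ρ, HasMFDerivAt 𝓘(ℝ, E) 𝓘(ℝ, ℝ) F
      ((extChartAt 𝓘(ℝ, E) p).symm z) (W.form.toFun ((extChartAt 𝓘(ℝ, E) p).symm z)))
    (hy : y ∈ Metric.ball (extChartAt 𝓘(ℝ, E) p p) ρ)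
    (hyT : y + T • e ∈ Metric.ball (extChartAt 𝓘(ℝ, E) p p) ρ)
    (hyδ : ‖y - extChartAt 𝓘(ℝ, E) p p‖ < T * δ)
    (hγ : W.metric.IsTimelikeFrom γ a m b) (ha : γ a = p)
    (hb : γ b = (extChartAt 𝓘(ℝ, E) p).symm y)
    (hneg : W.metric.toFun (γ b) (velocityOn γ m b b : E) (chartSymmDeriv p y e : E) < 0) :
    W.form.curveIntegral γ a b = F ((extChartAt 𝓘(ℝ, E) p).symm y) - F p := by
  set y₀ := extChartAt 𝓘(ℝ, E) p p with hy₀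
  have hy₀mem : y₀ ∈ Metric.ball y₀ ρ := Metric.mem_ball_self hcone.radius_pos
  set w : E := T⁻¹ • (y - y₀) + e with hw
  have hwT : y₀ + T • w = y + T • e := by
    rw [hw, smul_add, smul_smul, mul_inv_cancel₀ hT.ne', one_smul]
    abel
  have hwball : w ∈ Metric.ball e δ := by
    rw [Metric.mem_ball, dist_eq_norm, hw, add_sub_cancel_right, norm_smul, norm_inv,
      Real.norm_of_nonneg hT.le]
    rwa [inv_mul_lt_iff₀ hT]
  have hint : ∀ z ∈ Metric.ball y₀ ρ, ∀ v, z + T • v ∈ Metric.ball y₀ ρ →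
      ∫ s in (0 : ℝ)..T, W.form.chartForm p (z + s • v) v
        = F ((extChartAt 𝓘(ℝ, E) p).symm (z + T • v)) - F ((extChartAt 𝓘(ℝ, E) p).symm z) := by
    intro z hz v hv
    have hseg : ∀ s ∈ Icc (0 : ℝ) T, z + s • v ∈ Metric.ball y₀ ρ := fun s hs ↦
      add_smul_mem_of_convex (convex_ball _ _) hz hv hs
    exact OneForm.integral_chartForm_segment hT.le (fun s hs ↦ hcone.ball_subset (hseg s hs))
      fun s hs ↦ hF _ (hseg s hs)
  have hseg₁ := hcone.isTimelikeSegment hy (Metric.mem_ball_self hcone.aperture_pos) hyT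
  have hseg₂ := hcone.isTimelikeSegment hy₀mem hwball (by rwa [hwT])
  obtain ⟨γ', h1, h2, h3, -, h4⟩ := hγ.exists_extend hb hT hseg₁ hneg
  have h5 := hseg₂.joins hT
  rw [hwT, hy₀, extChartAt_to_inv] at h5
  have h6 := hW p _ _ _ _ _ _ _ (h1.joins (h2.trans ha) h3) h5
  rw [h4, hseg₂.curveIntegral hT, hint y hy e hyT, hint y₀ hy₀mem w (by rwa [hwT]), hwT, hy₀,
    extChartAt_to_inv] at h6
  linarith

/-- Near `p`, the potential, where it is defined by a time-like curve, is the increment of a local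
primitive: a time-like curve arriving near `p` can be prolonged either in the direction of a fixed
time-like vector `e` or in the direction of `-e`. -/
theorem IsPathIndependent.exists_primitive_near (hW : W.IsPathIndependent) (p : M) :
    ∃ (U : Set M) (F : M → ℝ), IsOpen U ∧ p ∈ U ∧ F p = 0 ∧ W.form.IsPrimitiveOn F U ∧
      ∀ q ∈ U ∩ W.metric.causalSet p, W.potential p q = F q := by
  obtain ⟨U₀, hU₀, hpU₀, F, hF⟩ := hW.isLocallyExact p
  set φ := extChartAt 𝓘(ℝ, E) p with hφ
  have hN : φ.symm ⁻¹' U₀ ∈ 𝓝 (φ p) := by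
    refine (continuousAt_extChartAt_symm p).preimage_mem_nhds (hU₀.mem_nhds ?_)
    rwa [extChartAt_to_inv]
  obtain ⟨e, ρ, δ, hcone, hball⟩ := W.metric.exists_isUniformCone_subset hN
  have hρ := hcone.radius_pos
  have hδ := hcone.aperture_pos
  set T : ℝ := ρ / (2 * (‖e‖ + 1)) with hT
  have hTpos : 0 < T := by positivity
  have hTe : T * ‖e‖ < ρ / 2 := by
    have : T * (‖e‖ + 1) = ρ / 2 := by
      rw [hT]
      field_simp
    linarith
  set r : ℝ := min (ρ / 2) (T * δ) with hr
  have hrpos : 0 < r := lt_min (half_pos hρ) (by positivity)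
  refine ⟨φ.source ∩ φ ⁻¹' Metric.ball (φ p) r, fun x ↦ F x - F p,
    (continuousOn_extChartAt p).isOpen_inter_preimage (isOpen_extChartAt_source p)
      Metric.isOpen_ball, ⟨mem_extChartAt_source p, Metric.mem_ball_self hrpos⟩, sub_self _, ?_, ?_⟩
  · refine OneForm.isPrimitiveOn_of_hasMFDerivAt
      ((continuousOn_extChartAt p).isOpen_inter_preimage (isOpen_extChartAt_source p)
        Metric.isOpen_ball) fun x hx ↦ ?_
    have hxU : x ∈ U₀ := by
      have h1 : φ x ∈ Metric.ball (φ p) ρ := by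
        have := (show dist (φ x) (φ p) < r from hx.2).trans_le (min_le_left _ _)
        rw [Metric.mem_ball]
        linarith
      have h2 : φ.symm (φ x) ∈ U₀ := hball h1
      rwa [φ.left_inv hx.1] at h2
    exact ((hF.2 x hxU).sub (hasMFDerivAt_const (I := 𝓘(ℝ, E)) (I' := 𝓘(ℝ, ℝ))
      (F p) x)).congr_mfderiv (sub_zero _)
  · rintro q ⟨⟨hq, hqr⟩, γ, a, b, hγ⟩
    rw [hW.potential_eq hγ]
    obtain ⟨hγ, ha, hb⟩ := hγ
    obtain ⟨m, hm⟩ := LorentzMetric.isTimelikeCurve_iff_exists.1 hγ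
    have hdist : dist (φ q) (φ p) < r := hqr
    have hqρ : φ q ∈ Metric.ball (φ p) ρ := by
      have := hdist.trans_le (min_le_left _ _)
      rw [Metric.mem_ball]
      linarith
    have hqδ : ‖φ q - φ p‖ < T * δ := by
      rw [← dist_eq_norm]
      exact hdist.trans_le (min_le_right _ _)
    have hqT : ∀ v : E, ‖v‖ = ‖e‖ → φ q + T • v ∈ Metric.ball (φ p) ρ := by
      intro v hv
      have h1 := hdist.trans_le (min_le_left _ _)
      rw [Metric.mem_ball, dist_eq_norm, add_sub_right_comm]
      refine (norm_add_le _ _).trans_lt ?_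
      rw [norm_smul, Real.norm_of_nonneg hTpos.le, hv, ← dist_eq_norm]
      linarith
    have hF' : ∀ z ∈ Metric.ball (φ p) ρ, HasMFDerivAt 𝓘(ℝ, E) 𝓘(ℝ, ℝ) F (φ.symm z)
        (W.form.toFun (φ.symm z)) := fun z hz ↦ hF.2 _ (hball hz)
    have hbq : γ b = φ.symm (φ q) := by rw [hb, φ.left_inv hq]
    have hneg : W.metric.toFun (γ b) (chartSymmDeriv p (φ q) e : E)
        (chartSymmDeriv p (φ q) e : E) < 0 := by
      refine lt_of_eq_of_lt ?_ (hcone.neg (φ q) hqρ e (Metric.mem_ball_self hδ) e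
        (Metric.mem_ball_self hδ))
      exact W.metric.toFun_congr_point hbq _ _
    have hne := W.metric.toFun_ne_zero_of_timelike (hm.lastPiece.2 b ⟨hm.lt_right.le, le_rfl⟩) hneg
    have hfin : W.form.curveIntegral γ a b = F (φ.symm (φ q)) - F p := by
      rcases lt_or_gt_of_ne hne with hlt | hgt
      · exact hW.curveIntegral_eq_of_cone hcone hTpos hF' hqρ (hqT e rfl) hqδ hm ha hbq hlt
      · refine hW.curveIntegral_eq_of_cone hcone.neg_direction hTpos hF' hqρ
          (hqT (-e) (norm_neg e)) hqδ hm ha hbq ?_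
        rw [map_neg]
        exact (map_neg _ _).trans_lt (neg_lt_zero.2 hgt)
    rw [hfin, φ.left_inv hq]

end WeylManifold

end WeylSpaceTime

namespace WeylSpaceTime

variable {E : Type*} [NormedAddCommGroup E] [NormedSpace ℝ E]
  {M : Type*} [TopologicalSpace M] [ChartedSpace E M] [IsManifold 𝓘(ℝ, E) ∞ M]

/-! ### Locally exact forms on simply connected manifolds -/

namespace OneForm

variable {θ : OneForm E M} {F F' : M → ℝ} {U U' : Set M} {x : M}

/-- Two primitives of the same 1-form differ by a locally constant function. -/
lemma IsPrimitiveOn.eventually_sub_eq (hF : θ.IsPrimitiveOn F U) (hF' : θ.IsPrimitiveOn F' U')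
    (hU : IsOpen U) (hU' : IsOpen U') (hx : x ∈ U ∩ U') :
    ∀ᶠ x' in 𝓝 x, F x' - F' x' = F x - F' x := by
  set φ := extChartAt 𝓘(ℝ, E) x with hφ
  have hV : φ.target ∩ φ.symm ⁻¹' (U ∩ U') ∈ 𝓝 (φ x) := by
    refine ((continuousOn_extChartAt_symm x).isOpen_inter_preimage (isOpen_extChartAt_target x)
      (hU.inter hU')).mem_nhds ⟨mem_extChartAt_target x, ?_⟩
    rw [mem_preimage, hφ, extChartAt_to_inv]
    exact hx
  obtain ⟨r, hr, hball⟩ := Metric.mem_nhds_iff.1 hV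
  have hd : ∀ y ∈ Metric.ball (φ x) r,
      HasFDerivAt (fun y ↦ F (φ.symm y) - F' (φ.symm y)) (0 : E →L[ℝ] ℝ) y := by
    intro y hy
    obtain ⟨hyt, hyU, hyU'⟩ := hball hy
    have := (hasFDerivAt_comp_chart_symm hyt (hF.2 _ hyU)).sub
      (hasFDerivAt_comp_chart_symm hyt (hF'.2 _ hyU'))
    rwa [sub_self] at this
  filter_upwards [(continuousAt_extChartAt (I := 𝓘(ℝ, E)) x).preimage_mem_nhds
    (Metric.ball_mem_nhds _ hr), extChartAt_source_mem_nhds (I := 𝓘(ℝ, E)) x] with x' hx' hx's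
  have hconst := Metric.isOpen_ball.is_const_of_fderiv_eq_zero (𝕜 := ℝ)
    (convex_ball (φ x) r).isPreconnected
    (fun y hy ↦ (hd y hy).differentiableAt.differentiableWithinAt)
    (fun y hy ↦ (hd y hy).fderiv) hx' (Metric.mem_ball_self hr)
  have h1 : φ.symm (φ x) = x := extChartAt_to_inv x
  simpa only [← hφ, φ.left_inv hx's, h1] using hconst

end OneForm

/-- The real numbers with the discrete topology. -/
@[ext]
structure DiscreteReal where
  val : ℝ

instance : TopologicalSpace DiscreteReal := ⊥

instance : DiscreteTopology DiscreteReal := ⟨rfl⟩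

/-- The covering of `M` by the germs of primitives of a locally exact 1-form, as a bundle with
discrete fibre `ℝ`. The element `c` of the fibre, in the trivialization given by the local
primitive `F i`, stands for the germ of the primitive `F i + c`. -/
def primitiveBundle {θ : OneForm E M} {U : M → Set M} {F : M → M → ℝ} (hU : ∀ x, IsOpen (U x))
    (hx : ∀ x, x ∈ U x) (hF : ∀ x, θ.IsPrimitiveOn (F x) (U x)) :
    FiberBundleCore M M DiscreteReal where
  baseSet := U
  isOpen_baseSet := hU
  indexAt := id
  mem_baseSet_at := hx
  coordChange i j x c := ⟨c.val + (F i x - F j x)⟩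
  coordChange_self i x _ c := by
    ext
    simp
  continuousOn_coordChange i j := by
    rintro ⟨x, c⟩ ⟨hxij, -⟩
    refine ContinuousAt.continuousWithinAt ?_
    have h1 := (hF i).eventually_sub_eq (hF j) (hU i) (hU j) hxij
    have h2 : ∀ᶠ c' in 𝓝 c, c' = c := by
      rw [nhds_discrete]
      rfl
    refine continuousAt_const.congr (f := fun _ ↦ ⟨c.val + (F i x - F j x)⟩) ?_
    filter_upwards [h1.prod_nhds h2] with q hq
    simp only [hq.1, hq.2]
  coordChange_comp i j k x _ c := by
    ext
    simp only
    ring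

/-- On a simply connected manifold, a locally exact 1-form is exact: the covering by the germs of
its primitives has a global section. -/
theorem OneForm.IsLocallyExact.isExact [FiniteDimensional ℝ E] [SimplyConnectedSpace M]
    {θ : OneForm E M} (h : θ.IsLocallyExact) : θ.IsExact := by
  choose U hU hx F hF using h
  set Z := primitiveBundle hU hx hF
  have hcov : IsCoveringMap (Bundle.TotalSpace.proj : Z.TotalSpace → M) :=
    FiberBundle.isCoveringMap
  have : LocallyPathConnectedSpace M := ChartedSpace.locallyPathConnectedSpace E M
  obtain ⟨x₀⟩ : Nonempty M := inferInstance
  obtain ⟨s, ⟨-, hs⟩, -⟩ := hcov.existsUnique_continuousMap_lifts (ContinuousMap.id M) x₀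
    (⟨x₀, (⟨0⟩ : DiscreteReal)⟩ : Z.TotalSpace) rfl
  have hs' : ∀ x, (s x).proj = x := fun x ↦ congrFun hs x
  set f : M → ℝ := fun x ↦ DiscreteReal.val (s x).2 + F (s x).proj (s x).proj
  refine ⟨f, isPrimitiveOn_of_hasMFDerivAt isOpen_univ fun x _ ↦ ?_⟩
  -- in the trivialization at `x`, the section is locally constant
  have h1 : ContinuousAt (fun x' ↦ (Z.localTriv x (s x')).2) x := by
    refine continuousAt_snd.comp
      (ContinuousAt.comp (g := Z.localTriv x) ?_ s.continuous.continuousAt)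
    exact (Z.localTriv x).continuousAt ((Z.mem_localTriv_source x (s x)).2 (by
      rw [hs']; exact hx x))
  have h2 : ∀ᶠ x' in 𝓝 x, (Z.localTriv x (s x')).2 = (Z.localTriv x (s x)).2 := by
    have := h1.eventually (show ∀ᶠ c in 𝓝 (Z.localTriv x (s x)).2,
      c = (Z.localTriv x (s x)).2 by rw [nhds_discrete]; rfl)
    exact this
  have h3 : ∀ x', (Z.localTriv x (s x')).2.val = f x' - F x x' := by
    intro x'
    have : (Z.localTriv x (s x')).2.val
        = DiscreteReal.val (s x').2 + (F (s x').proj (s x').proj - F x (s x').proj) := rfl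
    have hf' : f x' = DiscreteReal.val (s x').2 + F (s x').proj (s x').proj := rfl
    rw [this, hf', ← congrArg (F x) (hs' x')]
    ring
  have h4 : f =ᶠ[𝓝 x] fun x' ↦ F x x' + (f x - F x x) := by
    filter_upwards [h2] with x' hx'
    have h5 : f x' - F x x' = f x - F x x := by
      rw [← h3, ← h3]
      exact congrArg DiscreteReal.val hx'
    linarith
  have h5 := ((hF x).2 x (hx x)).add
    (hasMFDerivAt_const (I := 𝓘(ℝ, E)) (I' := 𝓘(ℝ, ℝ)) (f x - F x x) x)
  exact (h5.congr_mfderiv (add_zero _)).congr_of_eventuallyEq h4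

/-- Exactness of the 1-form is invariant under Weyl transformations, because these change it by the
differential of a smooth function. -/
lemma WeylManifold.isIntegrable_toWeylStructure {W : WeylManifold E M} [FiniteDimensional ℝ E]
    (h : W.form.IsExact) : W.toWeylStructure.IsIntegrable := by
  intro W' hW'
  obtain ⟨f, -, -, hf⟩ : GaugeEquiv W' W := Quotient.exact hW'
  obtain ⟨φ, hφ⟩ := h
  refine ⟨f + φ, OneForm.isPrimitiveOn_of_hasMFDerivAt isOpen_univ fun x hx ↦ ?_⟩
  exact ((hf x).add (hφ.2 x hx)).congr_mfderiv (sub_add_cancel _ _)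

end WeylSpaceTime

theorem mainTheorem4
    {E : Type*} [NormedAddCommGroup E] [NormedSpace ℝ E] [FiniteDimensional ℝ E]
    {M : Type*} [TopologicalSpace M] [ChartedSpace E M] [IsManifold 𝓘(ℝ, E) ∞ M] [T2Space M]
    (W : WeylSpaceTime.WeylManifold E M) (hW : W.IsPathIndependent) :
    (∀ p : M, IsOpen (W.metric.causalSet p) ∧
      ∃ f : M → ℝ, f p = 0 ∧
        (∀ (q : M) (γ : ℝ → M) (a b : ℝ), W.metric.Joins γ a b p q →
          f q = W.form.curveIntegral γ a b) ∧
        ∃ U : Set M, IsOpen U ∧ p ∈ U ∧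
          W.form.IsPrimitiveOn f (W.metric.causalSet p ∪ U)) ∧
    W.form.IsLocallyExact ∧
    W.form.IsClosedForm ∧
    (SimplyConnectedSpace M → W.form.IsExact ∧ W.toWeylStructure.IsIntegrable) := by
  refine ⟨fun p ↦ ⟨W.metric.isOpen_causalSet p, ?_⟩, hW.isLocallyExact,
    hW.isLocallyExact.isClosedForm, fun _ ↦ ?_⟩
  · obtain ⟨U, F, hU, hpU, hFp, hF, hUF⟩ := hW.exists_primitive_near p
    classical
    set f : M → ℝ := fun x ↦ if x ∈ W.metric.causalSet p then W.potential p x else F x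
    have hfI : EqOn f (W.potential p) (W.metric.causalSet p) := fun x hx ↦ if_pos hx
    have hfU : EqOn f F U := by
      intro x hx
      by_cases hxI : x ∈ W.metric.causalSet p
      · rw [hfI hxI, hUF x ⟨hx, hxI⟩]
      · exact if_neg hxI
    refine ⟨f, by rw [hfU hpU, hFp], fun q γ a b hγ ↦ ?_, U, hU, hpU, ?_⟩
    · rw [hfI ⟨γ, a, b, hγ⟩, hW.potential_eq hγ]
    · have hI := W.metric.isOpen_causalSet p
      refine WeylSpaceTime.OneForm.isPrimitiveOn_of_hasMFDerivAt (hI.union hU) fun x hx ↦ ?_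
      rcases hx with hx | hx
      · exact (hW.hasMFDerivAt_potential hx).congr_of_eventuallyEq
          (hfI.eventuallyEq_of_mem (hI.mem_nhds hx))
      · exact (hF.2 x hx).congr_of_eventuallyEq (hfU.eventuallyEq_of_mem (hU.mem_nhds hx))
  · have hexact := hW.isLocallyExact.isExact
    exact ⟨hexact, WeylSpaceTime.WeylManifold.isIntegrable_toWeylStructure hexact⟩
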